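/- Let $k$ be a field and let $(H,\sigma)$ be a coquasitriangular (CQT) Hopf algebra over $k$, i.e. $H$ is a Hopf algebra with antipode $S$ and $\sigma:H\otimes H\to k$ is a convolution invertible bilinear form with $\sigma(hh',g)=\sigma(h,g_1)\sigma(h',g_2)$, $\sigma(g,hh')=\sigma(g_2,h)\sigma(g_1,h')$, $\sigma(1,h)=\sigma(h,1)=\varepsilon(h)$ and $\sigma(h_1,h'_1)h_2h'_2=h'_1h_1\sigma(h_2,h'_2)$. Notation. (a) $\mathcal M^{(H,\varsigma)}$ is the category of right $H$-comodules with tensor product coaction $m\otimes n\mapsto m_{(0)}\otimes n_{(0)}\otimes m_{(1)}n_{(1)}$ and braiding $c(m\otimes n)=\varsigma(m_{(1)},n_{(1)})\,n_{(0)}\otimes m_{(0)}$. (b) For a CQT Hopf algebra $(K,\varsigma)$ with bijective antipode, let $D(K,K)$ be the generalized quantum double: the coalgebra $K\otimes K$ with unit $1\otimes 1$, multiplication $(b\otimes h)(b'\otimes h')=\varsigma(b'_1,h_1)\,\varsigma^{-1}(b'_3,h_3)\,bb'_2\otimes h_2h'$ and antipode $S_D(b\otimes h)=(1\otimes S(h))(S(b)\otimes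 1)$. Let $i(b)=b\otimes 1$ and $\pi(b\otimes h)=bh$, so that $\pi\circ i=\mathrm{id}_K$, and let $B=\{a\in D(K,K): a_1\otimes\pi(a_2)=a\otimes 1\}$ with its structure from Radford's theorem on Hopf algebras with a projection: left $K$-coaction $b\mapsto\pi(b_1)\otimes b_2$, multiplication, unit and counit of $D(K,K)$, comultiplication $b\mapsto\Pi(b_1)\otimes\Pi(b_2)$, where $\Pi(a)=a_1\,i(S(\pi(a_2)))$, and antipode $b\mapsto i(\pi(b_1))\,S_D(b_2)$. Then $\underline K$ denotes the vector space $K$ with the structure transported from $B$ along the bijection $\theta:K\to B$, $\theta(y)=S^{-1}(y_2)\otimes y_1$, whose inverse is the restriction of $\varepsilon\otimes\mathrm{id}$. (c) Let $H^{\rm cop}$ be $H$ with the flipped comultiplication and antipode $S^{-1}$, and let $\sigma_{21}(a,b)=\sigma(b,a)$. Regard $\underline{H^{\rm cop}}$, constructed from $(H^{\rm cop},\sigma_{21})$, as a structure in right $H$-comodules, the coaction $v\mapsto v_{-1}\otimes v_0$ becoming $v\mapsto v_0\otimes v_{-1}$. It lives in $\mathcal M^{(H,\sigma_{21}^{-1})}$,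 where $\sigma_{21}^{-1}(a,b)=\sigma^{-1}(b,a)$. Its co-opposite $(\underline{H^{\rm cop}})^{\rm cop}$ has comultiplication $c^{-1}\circ\underline\Delta$ ($c$ the braiding of $\mathcal M^{(H,\sigma_{21}^{-1})}$), antipode $\underline S^{-1}$, and all other structure maps unchanged. (d) Majid's function algebra braided group $\underline{\underline H}$ is the coalgebra $H$ with the unit of $H$, right coaction $h\mapsto h_2\otimes S(h_1)h_3$, multiplication $h\cdot g=\sigma(S(h_1)h_3,S(g_1))\,h_2g_2$ and antipode $h\mapsto\sigma(S^2(h_3)S(h_1),h_4)\,S(h_2)$. Proposition. The antipode $S$ of $H$, the map $\theta:H^{\rm cop}\to B$ (for $K=H^{\rm cop}$), the braiding $c$ on $\underline{H^{\rm cop}}\otimes\underline{H^{\rm cop}}$ and the antipode of $\underline{H^{\rm cop}}$ are bijective, so the above is well defined, and $$(\underline{H^{\rm cop}})^{\rm cop}=\underline{\underline H}$$ as braided Hopf algebras in $\mathcal M^{(H,\sigma)}$: the right $H$-coactions, multiplications, units, comultiplications, counits and antipodes coincide, and with these structure maps $H$ is a Hopf algebra in the braided category $\mathcal M^{(H,\sigma)}$.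 -/

import Mathlib

open scoped TensorProduct
open TensorProduct Coalgebra HopfAlgebra WithConv

noncomputable section

namespace BraidedTransmutation

/-! ## The co-opposite Hopf algebra -/

/-- The co-opposite `H^cop`: a copy of the algebra `H`, with the flipped comultiplication. -/
structure Cop (H : Type*) where
  /-- The copy in `H^cop` of an element of `H`. -/
  of ::
  /-- The underlying element of `H`. -/
  val : H

namespace Cop

/-- The identity map `H^cop → H`, as a bijection. -/
def toEquiv (H : Type*) : Cop H ≃ H := ⟨val, of, fun _ => rfl, fun _ => rfl⟩

variable (k H : Type*) [Field k] [Ring H]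

instance : Ring (Cop H) := (toEquiv H).ring

instance [Algebra k H] : Algebra k (Cop H) := (toEquiv H).algebra k

/-- The identity map `H^cop → H`, as an isomorphism of algebras. -/
def toAlgEquiv [Algebra k H] : Cop H ≃ₐ[k] H := (toEquiv H).algEquiv k

/-- The identity map `H^cop → H`, as a linear isomorphism. -/
def equiv [Algebra k H] : Cop H ≃ₗ[k] H := (toAlgEquiv k H).toLinearEquiv

/-- `Δ^cop(h) = h₂ ⊗ h₁` and `ε^cop = ε`. -/
instance [Bialgebra k H] : CoalgebraStruct k (Cop H) where
  comul := TensorProduct.map (equiv k H).symm.toLinearMap (equiv k H).symm.toLinearMap ∘ₗ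
    (TensorProduct.comm k H H).toLinearMap ∘ₗ comul ∘ₗ (equiv k H).toLinearMap
  counit := counit ∘ₗ (equiv k H).toLinearMap

/-- The permutation `a ⊗ (b ⊗ c) ↦ c ⊗ (b ⊗ a)`, in the identification `H^cop = H`. -/
def rev [Algebra k H] : H ⊗[k] (H ⊗[k] H) →ₗ[k] Cop H ⊗[k] (Cop H ⊗[k] Cop H) :=
  TensorProduct.map (equiv k H).symm.toLinearMap
      (TensorProduct.map (equiv k H).symm.toLinearMap (equiv k H).symm.toLinearMap) ∘ₗ
    (TensorProduct.assoc k H H H).toLinearMap ∘ₗ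
    (TensorProduct.comm k H (H ⊗[k] H)).toLinearMap ∘ₗ
    (TensorProduct.comm k H H).toLinearMap.lTensor H

variable {H}

theorem comul_apply [Bialgebra k H] (h : Cop H) :
    comul (R := k) h =
      TensorProduct.map (equiv k H).symm.toLinearMap (equiv k H).symm.toLinearMap
        (TensorProduct.comm k H H (comul (equiv k H h))) := rfl

theorem counit_apply [Bialgebra k H] (h : Cop H) :
    counit (R := k) h = counit (R := k) (equiv k H h) := rfl

instance [Bialgebra k H] : Coalgebra k (Cop H) where
  coassoc := by
    have key1 : ∀ z : H ⊗[k] H, ∀ y : H,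
        TensorProduct.assoc k (Cop H) (Cop H) (Cop H)
          (TensorProduct.map (equiv k H).symm.toLinearMap (equiv k H).symm.toLinearMap
            (TensorProduct.comm k H H z) ⊗ₜ[k] (equiv k H).symm y) =
        rev k H (y ⊗ₜ z) := by
      intro z y
      induction z with
      | zero => simp
      | add a b ha hb => simp only [map_add, TensorProduct.add_tmul, TensorProduct.tmul_add, ha, hb]
      | tmul a b => simp [rev]
    have key2 : ∀ z : H ⊗[k] H, ∀ y : H,
        (equiv k H).symm y ⊗ₜ[k]
          (TensorProduct.map (equiv k H).symm.toLinearMap (equiv k H).symm.toLinearMap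
            (TensorProduct.comm k H H z)) =
        rev k H (TensorProduct.assoc k H H H (z ⊗ₜ y)) := by
      intro z y
      induction z with
      | zero => simp
      | add a b ha hb => simp only [map_add, TensorProduct.add_tmul, TensorProduct.tmul_add, ha, hb]
      | tmul a b => simp [rev]
    have step1 : ∀ x : H ⊗[k] H,
        TensorProduct.assoc k (Cop H) (Cop H) (Cop H)
          ((comul (R := k) (A := Cop H)).rTensor (Cop H)
            (TensorProduct.map (equiv k H).symm.toLinearMap (equiv k H).symm.toLinearMap
            (TensorProduct.comm k H H x))) =
        rev k H ((comul (R := k) (A := H)).lTensor H x) := by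
      intro x
      induction x with
      | zero => simp
      | add a b ha hb => simp only [map_add, ha, hb]
      | tmul a b => simpa [comul_apply] using key1 (comul b) a
    have step2 : ∀ x : H ⊗[k] H,
        ((comul (R := k) (A := Cop H)).lTensor (Cop H)
            (TensorProduct.map (equiv k H).symm.toLinearMap (equiv k H).symm.toLinearMap
            (TensorProduct.comm k H H x))) =
        rev k H (TensorProduct.assoc k H H H ((comul (R := k) (A := H)).rTensor H x)) := by
      intro x
      induction x with
      | zero => simp
      | add a b ha hb => simp only [map_add, ha, hb]
      | tmul a b => simpa [comul_apply] using key2 (comul a) b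
    ext h
    simp only [LinearMap.comp_apply, LinearEquiv.coe_coe]
    rw [comul_apply, step1, step2, Coalgebra.coassoc_apply]
  rTensor_counit_comp_comul := by
    have step : ∀ x : H ⊗[k] H,
        (counit (R := k) (A := Cop H)).rTensor (Cop H)
            (TensorProduct.map (equiv k H).symm.toLinearMap (equiv k H).symm.toLinearMap
            (TensorProduct.comm k H H x)) =
        TensorProduct.map LinearMap.id (equiv k H).symm.toLinearMap
          (TensorProduct.comm k H k ((counit (R := k) (A := H)).lTensor H x)) := by
      intro x
      induction x with
      | zero => simp
      | add a b ha hb => simp only [map_add, ha, hb]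
      | tmul a b => simp [counit_apply]
    ext h
    simp only [LinearMap.comp_apply]
    rw [comul_apply, step, Coalgebra.lTensor_counit_comul]
    simp
  lTensor_counit_comp_comul := by
    have step : ∀ x : H ⊗[k] H,
        (counit (R := k) (A := Cop H)).lTensor (Cop H)
            (TensorProduct.map (equiv k H).symm.toLinearMap (equiv k H).symm.toLinearMap
            (TensorProduct.comm k H H x)) =
        TensorProduct.map (equiv k H).symm.toLinearMap LinearMap.id
          (TensorProduct.comm k k H ((counit (R := k) (A := H)).rTensor H x)) := by
      intro x
      induction x with
      | zero => simp
      | add a b ha hb => simp only [map_add, ha, hb]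
      | tmul a b => simp [counit_apply]
    ext h
    simp only [LinearMap.comp_apply]
    rw [comul_apply, step, Coalgebra.rTensor_counit_comul]
    simp

instance [Bialgebra k H] : Bialgebra k (Cop H) :=
  Bialgebra.mk' k (Cop H)
    (by simp [counit_apply, equiv])
    (by intro a b; simp [counit_apply, equiv])
    (by
      rw [comul_apply]
      simp [equiv, Algebra.TensorProduct.one_def])
    (by
      have step : ∀ x y : H ⊗[k] H,
          TensorProduct.map (equiv k H).symm.toLinearMap (equiv k H).symm.toLinearMap
            (TensorProduct.comm k H H (x * y)) =
          TensorProduct.map (equiv k H).symm.toLinearMap (equiv k H).symm.toLinearMap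
            (TensorProduct.comm k H H x) *
          TensorProduct.map (equiv k H).symm.toLinearMap (equiv k H).symm.toLinearMap
            (TensorProduct.comm k H H y) := by
        intro x y
        induction x with
        | zero => simp
        | add a b ha hb => simp only [map_add, add_mul, ha, hb]
        | tmul a b =>
          induction y with
          | zero => simp
          | add c d hc hd => simp only [map_add, mul_add, hc, hd]
          | tmul c d => simp [equiv]
      intro a b
      simp only [comul_apply]
      rw [← step, ← Bialgebra.comul_mul]
      simp [equiv])

/-- The antipode of `H^cop` is the inverse of the antipode of `H` (it is an antipode as soon as the
antipode of `H` is bijective). -/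
instance [HopfAlgebra k H] : HopfAlgebraStruct k (Cop H) where
  antipode := (equiv k H).symm.toLinearMap ∘ₗ
    (Ring.inverse (antipode k : Module.End k H)) ∘ₗ (equiv k H).toLinearMap

end Cop

/-! ## Coquasitriangular structures -/

section Coquasitriangular

variable {k H : Type*} [Field k] [Ring H] [Bialgebra k H]

/-- `σ` is a coquasitriangular structure on the bialgebra `H`: a convolution invertible skew pairing
with `σ(h₁, g₁) h₂ g₂ = g₁ h₁ σ(h₂, g₂)`. -/
structure IsCoquasitriangular (σ : H →ₗ[k] H →ₗ[k] k) : Prop where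
  isUnit : IsUnit (toConv (TensorProduct.lift σ))
  /-- `σ(h h', g) = σ(h, g₁) σ(h', g₂)`. -/
  mul_left : ∀ h h' g : H, σ (h * h') g =
    LinearMap.mul' k k (TensorProduct.map (σ h) (σ h') (comul g))
  /-- `σ(g, h h') = σ(g₂, h) σ(g₁, h')`. -/
  mul_right : ∀ g h h' : H, σ g (h * h') =
    LinearMap.mul' k k (TensorProduct.map (σ.flip h') (σ.flip h) (comul g))
  one_left : ∀ h : H, σ 1 h = counit h
  one_right : ∀ h : H, σ h 1 = counit h
  /-- An identity in the convolution algebra of linear maps `H ⊗ H → H`. -/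
  comm :
    toConv (Algebra.linearMap k H ∘ₗ TensorProduct.lift σ) * toConv (LinearMap.mul' k H) =
      toConv (LinearMap.mul' k H ∘ₗ (TensorProduct.comm k H H).toLinearMap) *
        toConv (Algebra.linearMap k H ∘ₗ TensorProduct.lift σ)

/-- The convolution inverse `σ⁻¹` of a bilinear form (`0` if there is none). -/
def convInv (σ : H →ₗ[k] H →ₗ[k] k) : H →ₗ[k] H →ₗ[k] k :=
  TensorProduct.curry (Ring.inverse (toConv (TensorProduct.lift σ))).ofConv

end Coquasitriangular

/-! ## Braided Hopf algebras in the category of right comodules -/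

section Comodule

variable {k : Type*} [Field k]

/-- `id ⊗ f ⊗ id`, for a linear map `f : M₂ ⊗ M₃ → N₂ ⊗ N₃` on the two middle factors. -/
def midMap {M₁ M₂ M₃ M₄ N₂ N₃ : Type*}
    [AddCommGroup M₁] [AddCommGroup M₂] [AddCommGroup M₃] [AddCommGroup M₄]
    [AddCommGroup N₂] [AddCommGroup N₃]
    [Module k M₁] [Module k M₂] [Module k M₃] [Module k M₄] [Module k N₂] [Module k N₃]
    (f : M₂ ⊗[k] M₃ →ₗ[k] N₂ ⊗[k] N₃) :
    (M₁ ⊗[k] M₂) ⊗[k] (M₃ ⊗[k] M₄) →ₗ[k] (M₁ ⊗[k] N₂) ⊗[k] (N₃ ⊗[k] M₄) :=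
  (TensorProduct.assoc k M₁ N₂ (N₃ ⊗[k] M₄)).symm.toLinearMap ∘ₗ
    ((TensorProduct.assoc k N₂ N₃ M₄).toLinearMap ∘ₗ f.rTensor M₄ ∘ₗ
      (TensorProduct.assoc k M₂ M₃ M₄).symm.toLinearMap).lTensor M₁ ∘ₗ
    (TensorProduct.assoc k M₁ M₂ (M₃ ⊗[k] M₄)).toLinearMap

variable {H : Type*} [Ring H] [Bialgebra k H]
variable {V W : Type*} [AddCommGroup V] [Module k V] [AddCommGroup W] [Module k W]

/-- `ρ : V → V ⊗ H` is a right `H`-comodule structure. -/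
structure IsRightCoaction (ρ : V →ₗ[k] V ⊗[k] H) : Prop where
  coassoc : (TensorProduct.assoc k V H H).toLinearMap ∘ₗ ρ.rTensor H ∘ₗ ρ =
    (comul (R := k) (A := H)).lTensor V ∘ₗ ρ
  counit : (TensorProduct.rid k V).toLinearMap ∘ₗ (counit (R := k) (A := H)).lTensor V ∘ₗ ρ =
    LinearMap.id

/-- The coaction `v ⊗ w ↦ v₍₀₎ ⊗ w₍₀₎ ⊗ v₍₁₎ w₍₁₎` on a tensor product. -/
def tensorCoaction (ρV : V →ₗ[k] V ⊗[k] H) (ρW : W →ₗ[k] W ⊗[k] H) :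
    V ⊗[k] W →ₗ[k] (V ⊗[k] W) ⊗[k] H :=
  (LinearMap.mul' k H).lTensor (V ⊗[k] W) ∘ₗ
    (TensorProduct.tensorTensorTensorComm k V H W H).toLinearMap ∘ₗ TensorProduct.map ρV ρW

/-- The braiding `v ⊗ w ↦ ς(v₍₁₎, w₍₁₎) w₍₀₎ ⊗ v₍₀₎` of the category `M^(H,ς)`. -/
def braiding (ς : H →ₗ[k] H →ₗ[k] k) (ρV : V →ₗ[k] V ⊗[k] H) (ρW : W →ₗ[k] W ⊗[k] H) :
    V ⊗[k] W →ₗ[k] W ⊗[k] V :=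
  (TensorProduct.rid k (W ⊗[k] V)).toLinearMap ∘ₗ
    TensorProduct.map (TensorProduct.comm k V W).toLinearMap (TensorProduct.lift ς) ∘ₗ
    (TensorProduct.tensorTensorTensorComm k V H W H).toLinearMap ∘ₗ TensorProduct.map ρV ρW

variable (k H V) in
/-- The structure maps of a braided Hopf algebra with underlying space `V` in a category of
right `H`-comodules; the axioms are collected in `BraidedHopfData.IsBraidedHopfAlgebra`. -/
@[ext]
structure BraidedHopfData where
  coact : V →ₗ[k] V ⊗[k] H
  mul : V ⊗[k] V →ₗ[k] V
  one : V
  comul : V →ₗ[k] V ⊗[k] V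
  counit : V →ₗ[k] k
  antipode : V →ₗ[k] V

namespace BraidedHopfData

/-- The structure maps `E` form a Hopf algebra in the braided monoidal category `M^(H,ς)`. -/
structure IsBraidedHopfAlgebra (ς : H →ₗ[k] H →ₗ[k] k) (E : BraidedHopfData k H V) : Prop where
  isRightCoaction : IsRightCoaction E.coact
  /- The structure maps are morphisms of comodules. -/
  mul_colinear : E.coact ∘ₗ E.mul = E.mul.rTensor H ∘ₗ tensorCoaction E.coact E.coact
  one_colinear : E.coact E.one = E.one ⊗ₜ[k] (1 : H)
  comul_colinear : tensorCoaction E.coact E.coact ∘ₗ E.comul = E.comul.rTensor H ∘ₗ E.coact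
  counit_colinear : ∀ v : V, E.counit.rTensor H (E.coact v) = E.counit v ⊗ₜ[k] (1 : H)
  antipode_colinear : E.coact ∘ₗ E.antipode = E.antipode.rTensor H ∘ₗ E.coact
  /- An algebra. -/
  mul_assoc : E.mul ∘ₗ E.mul.rTensor V =
    E.mul ∘ₗ E.mul.lTensor V ∘ₗ (TensorProduct.assoc k V V V).toLinearMap
  one_mul : ∀ v : V, E.mul (E.one ⊗ₜ[k] v) = v
  mul_one : ∀ v : V, E.mul (v ⊗ₜ[k] E.one) = v
  /- A coalgebra. -/
  coassoc : (TensorProduct.assoc k V V V).toLinearMap ∘ₗ E.comul.rTensor V ∘ₗ E.comul =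
    E.comul.lTensor V ∘ₗ E.comul
  counit_comul : ∀ v : V, E.counit.rTensor V (E.comul v) = (1 : k) ⊗ₜ[k] v
  comul_counit : ∀ v : V, E.counit.lTensor V (E.comul v) = v ⊗ₜ[k] (1 : k)
  /- The comultiplication and the counit are multiplicative, for the braided tensor product. -/
  comul_mul : E.comul ∘ₗ E.mul =
    TensorProduct.map E.mul E.mul ∘ₗ midMap (braiding ς E.coact E.coact) ∘ₗ
      TensorProduct.map E.comul E.comul
  comul_one : E.comul E.one = E.one ⊗ₜ[k] E.one
  counit_mul : ∀ v w : V, E.counit (E.mul (v ⊗ₜ[k] w)) = E.counit v * E.counit w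
  counit_one : E.counit E.one = 1
  /- The antipode. -/
  antipode_left : ∀ v : V, E.mul (E.antipode.rTensor V (E.comul v)) = E.counit v • E.one
  antipode_right : ∀ v : V, E.mul (E.antipode.lTensor V (E.comul v)) = E.counit v • E.one

/-- The co-opposite of a braided Hopf algebra `E` in `M^(H,ς)` with braiding `c`: the
comultiplication is replaced by `c⁻¹ ∘ Δ` and the antipode by its inverse. It lives in the mirror
category, that is `M^(H,ς)` with the braiding `V ⊗ W → W ⊗ V` replaced by the inverse of
`c : W ⊗ V → V ⊗ W`. (`Ring.inverse` is the inverse of an invertible endomorphism, and `0` on the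
others.) -/
def cop (ς : H →ₗ[k] H →ₗ[k] k) (E : BraidedHopfData k H V) : BraidedHopfData k H V where
  coact := E.coact
  mul := E.mul
  one := E.one
  comul := Ring.inverse (braiding ς E.coact E.coact : Module.End k (V ⊗[k] V)) ∘ₗ E.comul
  counit := E.counit
  antipode := Ring.inverse (E.antipode : Module.End k V)

end BraidedHopfData

end Comodule

/-! ## The generalized quantum double `D(K,K)` as a Hopf algebra with a projection onto `K`

Here `ς` is a coquasitriangular structure on a Hopf algebra `K`. As a coalgebra, `D = D(K,K)` is the
tensor product `K ⊗ K` (with its coalgebra structure from the library), and its unit is `1 ⊗ 1`. -/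

namespace Double

variable {k K : Type*} [Field k] [Ring K] [HopfAlgebraStruct k K]

/-- `c ↦ f(c₁) c₂ g(c₃)` on a coalgebra `C`. -/
def twist {C : Type*} [AddCommGroup C] [Module k C] [Coalgebra k C] (f g : C →ₗ[k] k) :
    C →ₗ[k] C :=
  (TensorProduct.lid k C).toLinearMap ∘ₗ
    TensorProduct.map f ((TensorProduct.rid k C).toLinearMap ∘ₗ g.lTensor C ∘ₗ comul) ∘ₗ comul

/-- The multiplication
`(b ⊗ h) (b' ⊗ h') = ς(b'₁, h₁) ς⁻¹(b'₃, h₃) b b'₂ ⊗ h₂ h'` of `D(K,K)`. -/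
def mul (ς : K →ₗ[k] K →ₗ[k] k) : (K ⊗[k] K) ⊗[k] (K ⊗[k] K) →ₗ[k] K ⊗[k] K :=
  TensorProduct.map (LinearMap.mul' k K) (LinearMap.mul' k K) ∘ₗ
    midMap (twist (TensorProduct.lift ς) (TensorProduct.lift (convInv ς)) ∘ₗ
      (TensorProduct.comm k K K).toLinearMap)

variable (k K) in
/-- The inclusion `i : K → D(K,K)`, `i(b) = b ⊗ 1`. -/
def incl : K →ₗ[k] K ⊗[k] K := (TensorProduct.mk k K K).flip 1

variable (k K) in
/-- The projection `π : D(K,K) → K`, `π(b ⊗ h) = b h`, which splits `i`. -/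
def proj : K ⊗[k] K →ₗ[k] K := LinearMap.mul' k K

/-- The antipode `b ⊗ h ↦ (1 ⊗ S(h)) (S(b) ⊗ 1)` of `D(K,K)`. -/
def antipode (ς : K →ₗ[k] K →ₗ[k] k) : K ⊗[k] K →ₗ[k] K ⊗[k] K :=
  mul ς ∘ₗ
    TensorProduct.map (TensorProduct.mk k K K 1 ∘ₗ HopfAlgebra.antipode k)
      (incl k K ∘ₗ HopfAlgebra.antipode k) ∘ₗ
    (TensorProduct.comm k K K).toLinearMap

variable (k K) in
/-- The space `B = {a ∈ D | a₁ ⊗ π(a₂) = a ⊗ 1}` of coinvariants of the projection `π`, which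
carries the braided Hopf algebra structure with `D ≅ B × K` (Radford biproduct). -/
def coinvariants : Submodule k (K ⊗[k] K) :=
  LinearMap.eqLocus ((proj k K).lTensor (K ⊗[k] K) ∘ₗ comul)
    ((TensorProduct.mk k (K ⊗[k] K) K).flip 1)

/-- The map `Π(a) = a₁ i(S(π(a₂)))` from `D` onto `B`. -/
def toCoinvariants (ς : K →ₗ[k] K →ₗ[k] k) : K ⊗[k] K →ₗ[k] K ⊗[k] K :=
  mul ς ∘ₗ (incl k K ∘ₗ HopfAlgebra.antipode k ∘ₗ proj k K).lTensor (K ⊗[k] K) ∘ₗ comul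

/-- The left `K`-coaction `b ↦ π(b₁) ⊗ b₂` of `B`. -/
def coinvCoact : K ⊗[k] K →ₗ[k] K ⊗[k] (K ⊗[k] K) :=
  (proj k K).rTensor (K ⊗[k] K) ∘ₗ comul

/-- The comultiplication of `B`, given by `Π(a) ↦ Π(a₁) ⊗ Π(a₂)`; note `Π(b) = b` on `B`. -/
def coinvComul (ς : K →ₗ[k] K →ₗ[k] k) : K ⊗[k] K →ₗ[k] (K ⊗[k] K) ⊗[k] (K ⊗[k] K) :=
  TensorProduct.map (toCoinvariants ς) (toCoinvariants ς) ∘ₗ comul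

/-- The antipode `b ↦ i(π(b₁)) S_D(b₂)` of `B`. -/
def coinvAntipode (ς : K →ₗ[k] K →ₗ[k] k) : K ⊗[k] K →ₗ[k] K ⊗[k] K :=
  mul ς ∘ₗ TensorProduct.map (incl k K ∘ₗ proj k K) (antipode ς) ∘ₗ comul

variable (k K) in
/-- The isomorphism `θ : K → B`, `θ(y) = S⁻¹(y₂) ⊗ y₁`. -/
def theta : K →ₗ[k] K ⊗[k] K :=
  TensorProduct.map (Ring.inverse (HopfAlgebra.antipode k : Module.End k K)) LinearMap.id ∘ₗ
    (TensorProduct.comm k K K).toLinearMap ∘ₗ comul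

variable (k K) in
/-- The map `b ⊗ h ↦ ε(b) h`, whose restriction to `B` is the inverse of `θ`. -/
def thetaInv : K ⊗[k] K →ₗ[k] K :=
  (TensorProduct.lid k K).toLinearMap ∘ₗ (counit (R := k) (A := K)).rTensor K

end Double

/-! ## The two braided Hopf algebras -/

section

variable {k : Type*} [Field k]

/-- The structure maps of a braided Hopf algebra with underlying space `V` in a category of
left `K`-comodules. -/
structure LeftBraidedHopfData (k K V : Type*) [Field k] [Ring K] [Algebra k K]
    [AddCommGroup V] [Module k V] where
  coact : V →ₗ[k] K ⊗[k] V
  mul : V ⊗[k] V →ₗ[k] V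
  one : V
  comul : V →ₗ[k] V ⊗[k] V
  counit : V →ₗ[k] k
  antipode : V →ₗ[k] V

/-- The braided Hopf algebra `K̲` of a coquasitriangular Hopf algebra `(K,ς)`: the vector space `K`
with the structure transported along `θ : K ≅ B` from the coinvariants `B` of
`π : D(K,K) → K`. -/
def underline {K : Type*} [Ring K] [HopfAlgebraStruct k K] (ς : K →ₗ[k] K →ₗ[k] k) :
    LeftBraidedHopfData k K K where
  coact := (Double.thetaInv k K).lTensor K ∘ₗ Double.coinvCoact ∘ₗ Double.theta k K
  mul := Double.thetaInv k K ∘ₗ Double.mul ς ∘ₗ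
    TensorProduct.map (Double.theta k K) (Double.theta k K)
  one := Double.thetaInv k K (1 ⊗ₜ[k] 1)
  comul := TensorProduct.map (Double.thetaInv k K) (Double.thetaInv k K) ∘ₗ
    Double.coinvComul ς ∘ₗ Double.theta k K
  counit := counit ∘ₗ Double.theta k K
  antipode := Double.thetaInv k K ∘ₗ Double.coinvAntipode ς ∘ₗ Double.theta k K

variable {H : Type*} [Ring H] [HopfAlgebra k H]

/-- The identification of left `H^cop`-comodules with right `H`-comodules, for a structure on the
vector space `H^cop = H`: the coaction `v ↦ v₋₁ ⊗ v₀` becomes `v ↦ v₀ ⊗ v₋₁`. -/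
def LeftBraidedHopfData.ofCop (E : LeftBraidedHopfData k (Cop H) (Cop H)) :
    BraidedHopfData k H H where
  coact := (TensorProduct.comm k H H).toLinearMap ∘ₗ
    TensorProduct.map (Cop.equiv k H).toLinearMap (Cop.equiv k H).toLinearMap ∘ₗ
    E.coact ∘ₗ (Cop.equiv k H).symm.toLinearMap
  mul := (Cop.equiv k H).toLinearMap ∘ₗ E.mul ∘ₗ
    TensorProduct.map (Cop.equiv k H).symm.toLinearMap (Cop.equiv k H).symm.toLinearMap
  one := Cop.equiv k H E.one
  comul := TensorProduct.map (Cop.equiv k H).toLinearMap (Cop.equiv k H).toLinearMap ∘ₗ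
    E.comul ∘ₗ (Cop.equiv k H).symm.toLinearMap
  counit := E.counit ∘ₗ (Cop.equiv k H).symm.toLinearMap
  antipode := (Cop.equiv k H).toLinearMap ∘ₗ E.antipode ∘ₗ (Cop.equiv k H).symm.toLinearMap

/-- The form `σ₂₁(a, b) = σ(b, a)`, on `H^cop`. -/
def copForm (σ : H →ₗ[k] H →ₗ[k] k) : Cop H →ₗ[k] Cop H →ₗ[k] k :=
  σ.flip.compl₁₂ (Cop.equiv k H).toLinearMap (Cop.equiv k H).toLinearMap

/-- The braided Hopf algebra obtained by applying the construction `underline` to `(H^cop, σ₂₁)`,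
regarded as a structure in the category `M^(H, σ₂₁⁻¹)` of right `H`-comodules. -/
def underlineCop (σ : H →ₗ[k] H →ₗ[k] k) : BraidedHopfData k H H :=
  (underline (K := Cop H) (copForm σ)).ofCop

variable (k H) in
/-- The right adjoint coaction `h ↦ h₂ ⊗ S(h₁) h₃`. -/
def adjointCoact : H →ₗ[k] H ⊗[k] H :=
  (LinearMap.mul' k H ∘ₗ (HopfAlgebra.antipode k).rTensor H).lTensor H ∘ₗ
    (TensorProduct.leftComm k H H H).toLinearMap ∘ₗ comul.lTensor H ∘ₗ comul

/-- Majid's function algebra braided group of `(H,σ)`: the coalgebra `H` with the right adjoint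
coaction, the multiplication `h · g = σ(S(h₁) h₃, S(g₁)) h₂ g₂`, the unit of `H` and the antipode
`h ↦ σ(S²(h₃) S(h₁), h₄) S(h₂)`. -/
def functionBraidedGroup (σ : H →ₗ[k] H →ₗ[k] k) : BraidedHopfData k H H where
  coact := adjointCoact k H
  -- the argument `(h₂ ⊗ S(h₁) h₃) ⊗ (g₂ ⊗ g₁)` is regrouped as `(h₂ ⊗ g₂) ⊗ (S(h₁) h₃ ⊗ g₁)`
  mul := (TensorProduct.rid k H).toLinearMap ∘ₗ
    TensorProduct.map (LinearMap.mul' k H)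
      (TensorProduct.lift (σ.compl₂ (HopfAlgebra.antipode k))) ∘ₗ
    (TensorProduct.tensorTensorTensorComm k H H H H).toLinearMap ∘ₗ
    TensorProduct.map (adjointCoact k H) ((TensorProduct.comm k H H).toLinearMap ∘ₗ comul)
  one := 1
  comul := comul
  counit := counit
  -- `(h₁ ⊗ h₂) ⊗ (h₃ ⊗ h₄)` is regrouped as `h₂ ⊗ ((h₃ ⊗ h₁) ⊗ h₄)`
  antipode := (TensorProduct.rid k H).toLinearMap ∘ₗ
    TensorProduct.map (HopfAlgebra.antipode k)
      (TensorProduct.lift σ ∘ₗ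
        (LinearMap.mul' k H ∘ₗ
          TensorProduct.map (HopfAlgebra.antipode k ∘ₗ HopfAlgebra.antipode k)
            (HopfAlgebra.antipode k) ∘ₗ
          (TensorProduct.comm k H H).toLinearMap).rTensor H ∘ₗ
        (TensorProduct.assoc k H H H).symm.toLinearMap) ∘ₗ
    (TensorProduct.assoc k H H (H ⊗[k] H)).toLinearMap ∘ₗ
    ((TensorProduct.comm k H H).toLinearMap.rTensor (H ⊗[k] H)) ∘ₗ
    TensorProduct.map comul comul ∘ₗ comul

end

end BraidedTransmutation

end

/-! Both sides are governed by one right action, x ◁ b = σ(x₍₁₎, b) x₍₀₎ (`adjointAct`), where x₍₀₎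
⊗ x₍₁₎ = x₂ ⊗ S(x₁)x₃ is the adjoint coaction ρ. In the function algebra braided group the product
is x·y = (x ◁ S(y₁)) y₂ and the antipode is y ↦ S(y₁) ◁ y₂.

On the other side, the antipode of H^cop is T = S⁻¹, so in terms of H the map θ is y ↦ S(y₁) ⊗ y₂.
Applying ε ⊗ id to a product in the double gives (b ⊗ h)(b' ⊗ h') ↦ ε(b) (h ◁ b') h'
(`thetaInv_mul`), because the two pairings in that product merge into σ(S(h₁)h₃, b'). This formula
gives the same product, the antipode y ↦ T(y₂) ◁ y₁ (`skewAntipode`) and the comultiplication c ∘ Δ,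
with c the braiding for σ₂₁⁻¹; coaction, unit and counit are read off directly. Passing to the
co-opposite cancels c. The maps y ↦ T(y₂) ◁ y₁ and y ↦ S(y₁) ◁ y₂ are mutually inverse: both are
colinear, hence commute with ◁ (`map_adjointAct`), and the composites collapse. The inverse of c is
the braiding for σ.

Bijectivity of S comes from the Drinfeld functional v(y) = σ(y₁, S(y₂)): S² is convolution
conjugation by v, and v is invertible and S²-invariant.

For the Hopf algebra axioms, the commutation law of σ gives a second form of the product, x·y = y₍₀₎
(x ◂ y₍₁₎) with x ◂ g = σ(x₂, g) x₁ (`regularAct`). The action ◂ makes H a module algebra, so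
associativity follows from colinearity of the product; and ◂ factors as x ◂ g = σ(x₁, g₁) (x₂ ◁ g₂),
which is where the braiding in Δ(x·y) comes from. The left antipode law is immediate from the first
form of the product; the right one also needs v. -/

noncomputable section

namespace BraidedTransmutation

/-! ### Sweedler notation: sums over a decomposition of a tensor -/

section Sweedler

variable {k : Type*} [Field k] {U V W X M N : Type*}
  [AddCommGroup U] [Module k U] [AddCommGroup V] [Module k V] [AddCommGroup W] [Module k W]
  [AddCommGroup X] [Module k X] [AddCommGroup M] [AddCommGroup N]

/-- `∑ F(v, w)`, where `t = ∑ v ⊗ w` is a chosen decomposition of `t ∈ V ⊗ W`. If `F` is bilinear,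
this does not depend on the choice. -/
def sw (t : V ⊗[k] W) (F : V → W → M) : M :=
  ∑ p ∈ (TensorProduct.exists_finset t).choose, F p.1 p.2

theorem sw_tmul_eq (t : V ⊗[k] W) : sw t (fun v w => v ⊗ₜ[k] w) = t :=
  (TensorProduct.exists_finset t).choose_spec.symm

/-- The decompositions of `t` and `s` are fixed, so this exchanges two finite sums and needs no
linearity. -/
theorem sw_comm (t : V ⊗[k] W) (s : U ⊗[k] X) (F : V → W → U → X → M) :
    (sw t fun v w => sw s fun u x => F v w u x) = sw s fun u x => sw t fun v w => F v w u x :=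
  Finset.sum_comm

theorem sw_add (t : V ⊗[k] W) (F G : V → W → M) :
    (sw t fun v w => F v w + G v w) = sw t F + sw t G := Finset.sum_add_distrib

theorem sw_congr {t : V ⊗[k] W} {F G : V → W → M} (h : ∀ v w, F v w = G v w) : sw t F = sw t G := by
  congr; funext v w; exact h v w

variable [Module k M] [Module k N]

-- Independence of the chosen decomposition requires linearity in each variable. Registering
-- `IsLinearMap` with `fun_prop` makes these side conditions automatic, also inside `simp (disch :=
-- fun_prop)`.
attribute [fun_prop] IsLinearMap

@[fun_prop]
theorem isLinearMap_id : IsLinearMap k fun x : V => x := ⟨fun _ _ => rfl, fun _ _ => rfl⟩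

@[fun_prop]
theorem isLinearMap_comp {f : W → M} {g : V → W} (hf : IsLinearMap k f) (hg : IsLinearMap k g) :
    IsLinearMap k fun x => f (g x) :=
  ⟨fun _ _ => by rw [hg.map_add, hf.map_add], fun _ _ => by rw [hg.map_smul, hf.map_smul]⟩

@[fun_prop]
theorem isLinearMap_coe (f : V →ₗ[k] W) : IsLinearMap k fun x => f x := f.isLinear

@[fun_prop]
theorem isLinearMap_coe_equiv (f : V ≃ₗ[k] W) : IsLinearMap k fun x => f x :=
  f.toLinearMap.isLinear

@[fun_prop]
theorem isLinearMap_coe_apply (f : V →ₗ[k] W →ₗ[k] M) (w : W) :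
    IsLinearMap k fun x => f x w := (f.flip w).isLinear

@[fun_prop]
theorem isLinearMap_smul_right {f : V → W} (hf : IsLinearMap k f) (c : k) :
    IsLinearMap k fun x => c • f x :=
  ⟨fun _ _ => by rw [hf.map_add, smul_add], fun _ _ => by rw [hf.map_smul, smul_comm]⟩

@[fun_prop]
theorem isLinearMap_smul_left {f : V → k} (hf : IsLinearMap k f) (w : W) :
    IsLinearMap k fun x => f x • w :=
  ⟨fun _ _ => by rw [hf.map_add, add_smul], fun _ _ => by rw [hf.map_smul, smul_assoc]⟩

@[fun_prop]
theorem isLinearMap_mul_right {A : Type*} [Ring A] [Algebra k A] {f : V → A}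
    (hf : IsLinearMap k f) (a : A) : IsLinearMap k fun x => a * f x :=
  ⟨fun _ _ => by rw [hf.map_add, mul_add], fun _ _ => by rw [hf.map_smul, mul_smul_comm]⟩

@[fun_prop]
theorem isLinearMap_mul_left {A : Type*} [Ring A] [Algebra k A] {f : V → A}
    (hf : IsLinearMap k f) (a : A) : IsLinearMap k fun x => f x * a :=
  ⟨fun _ _ => by rw [hf.map_add, add_mul], fun _ _ => by rw [hf.map_smul, smul_mul_assoc]⟩

@[fun_prop]
theorem isLinearMap_tmul_right {f : V → W} (hf : IsLinearMap k f) (m : M) :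
    IsLinearMap k fun x => m ⊗ₜ[k] f x :=
  ⟨fun _ _ => by rw [hf.map_add, tmul_add], fun _ _ => by rw [hf.map_smul, tmul_smul]⟩

@[fun_prop]
theorem isLinearMap_tmul_left {f : V → W} (hf : IsLinearMap k f) (m : M) :
    IsLinearMap k fun x => f x ⊗ₜ[k] m :=
  ⟨fun _ _ => by rw [hf.map_add, add_tmul], fun _ _ => by rw [hf.map_smul, smul_tmul']⟩

theorem map_sw (f : M →ₗ[k] N) (t : V ⊗[k] W) (F : V → W → M) :
    f (sw t F) = sw t fun v w => f (F v w) := map_sum f _ _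

theorem _root_.IsLinearMap.map_sw {f : M → N} (hf : IsLinearMap k f) (t : V ⊗[k] W)
    (F : V → W → M) :
    f (sw t F) = sw t fun v w => f (F v w) := map_sum (hf.mk' f) _ _

theorem sw_smul (t : V ⊗[k] W) (c : k) (F : V → W → M) :
    (sw t fun v w => c • F v w) = c • sw t F := Finset.smul_sum.symm

theorem sw_eq_lift (t : V ⊗[k] W) (F : V →ₗ[k] W →ₗ[k] M) :
    (sw t fun v w => F v w) = TensorProduct.lift F t := by
  conv_rhs => rw [← sw_tmul_eq t, map_sw]
  simp

-- The choice of decomposition is not linear in the tensor; for bilinear `F`, however, the sum is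
-- the value of the lift of `F`, which no longer involves the choice.
@[fun_prop]
theorem isLinearMap_sw {f : M → V ⊗[k] W} {F : V → W → N} (hf : IsLinearMap k f)
    (h₁ : ∀ v, IsLinearMap k fun w => F v w) (h₂ : ∀ w, IsLinearMap k fun v => F v w) :
    IsLinearMap k fun x => sw (f x) fun v w => F v w := by
  have := ((TensorProduct.lift (LinearMap.mk₂ k F (fun a b c => (h₂ c).map_add a b)
    (fun c a b => (h₂ b).map_smul c a) (fun a b c => (h₁ a).map_add b c)
    (fun c a b => (h₁ a).map_smul c b))) ∘ₗ hf.mk' f).isLinear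
  convert! this using 2
  exact sw_eq_lift (f _) (LinearMap.mk₂ k F (fun a b c => (h₂ c).map_add a b)
    (fun c a b => (h₂ b).map_smul c a) (fun a b c => (h₁ a).map_add b c)
    (fun c a b => (h₁ a).map_smul c b))

@[fun_prop]
theorem isLinearMap_sw_body (t : V ⊗[k] W) {F : M → V → W → N}
    (h : ∀ v w, IsLinearMap k fun x => F x v w) :
    IsLinearMap k fun x => sw t fun v w => F x v w :=
  ⟨fun a b => by simp only [(h _ _).map_add, sw_add], fun c a => by
    simp only [(h _ _).map_smul, sw_smul]⟩

theorem sw_tmul (a : V) (b : W) (F : V → W → N)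
    (h₁ : ∀ v, IsLinearMap k fun w => F v w) (h₂ : ∀ w, IsLinearMap k fun v => F v w) :
    sw (a ⊗ₜ[k] b) F = F a b := by
  exact sw_eq_lift (a ⊗ₜ b) (LinearMap.mk₂ k F (fun a b c => (h₂ c).map_add a b)
    (fun c a b => (h₂ b).map_smul c a) (fun a b c => (h₁ a).map_add b c)
    (fun c a b => (h₁ a).map_smul c b))

theorem sw_sw (s : U ⊗[k] X) (G : U → X → V ⊗[k] W) (F : V → W → N)
    (h₁ : ∀ v, IsLinearMap k fun w => F v w) (h₂ : ∀ w, IsLinearMap k fun v => F v w) :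
    sw (sw s fun u x => G u x) F = sw s fun u x => sw (G u x) F :=
  _root_.IsLinearMap.map_sw (f := fun t => sw t F) (by fun_prop) _ _

/-- The entry into Sweedler notation: a structure map built from tensor combinators is evaluated on
pure tensors under the sum. -/
theorem apply_eq_sw {φ : V ⊗[k] W → M} (hφ : IsLinearMap k φ) (t : V ⊗[k] W) :
    φ t = sw t fun v w => φ (v ⊗ₜ w) := by
  conv_lhs => rw [← sw_tmul_eq t, hφ.map_sw]

theorem sw_map {V' W' : Type*} [AddCommGroup V'] [Module k V'] [AddCommGroup W'] [Module k W']
    (f : V →ₗ[k] V') (g : W →ₗ[k] W') (t : V ⊗[k] W) (F : V' → W' → M)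
    (h₁ : ∀ v, IsLinearMap k fun w => F v w) (h₂ : ∀ w, IsLinearMap k fun v => F v w) :
    sw (TensorProduct.map f g t) F = sw t fun v w => F (f v) (g w) := by
  rw [apply_eq_sw (φ := fun t => sw (TensorProduct.map f g t) F) (by fun_prop)]
  simp only [map_tmul]
  exact sw_congr fun v w => sw_tmul _ _ _ (by fun_prop) (by fun_prop)

theorem sw_swap (t : V ⊗[k] W) (F : W → V → M)
    (h₁ : ∀ w, IsLinearMap k fun v => F w v) (h₂ : ∀ v, IsLinearMap k fun w => F w v) :
    sw (TensorProduct.comm k V W t) F = sw t fun v w => F w v := by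
  rw [apply_eq_sw (φ := fun t => sw (TensorProduct.comm k V W t) F) (by fun_prop)]
  simp only [comm_tmul]
  exact sw_congr fun v w => sw_tmul _ _ _ (by fun_prop) (by fun_prop)

end Sweedler

/-! ### Coalgebra and convolution identities in Sweedler notation -/

section Coalgebra

variable {k C M : Type*} [Field k] [AddCommGroup C] [Module k C] [Coalgebra k C]
  [AddCommGroup M] [Module k M]

local notation "Δ" => comul (R := k)
local notation "ε" => counit (R := k)

/-- Used from left to right as a rewriting rule, this brings iterated comultiplications to the
right-nested normal form in which two expressions can be compared. -/
theorem sw_comul_assoc (h : C) (F : C → C → C → M)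
    (h₁ : ∀ a b, IsLinearMap k fun c => F c a b) (h₂ : ∀ a b, IsLinearMap k fun c => F a c b)
    (h₃ : ∀ a b, IsLinearMap k fun c => F a b c) :
    (sw (Δ h) fun a b => sw (Δ a) fun c d => F c d b) =
      sw (Δ h) fun a b => sw (Δ b) fun c d => F a c d := by
  have key := congrArg (fun t => sw t fun a s => sw s fun b c => F a b c)
    (Coalgebra.coassoc_apply (R := k) h)
  rw [apply_eq_sw (φ := fun t => sw (TensorProduct.assoc k C C C ((comul (R := k)).rTensor C t))
    fun a s => sw s fun b c => F a b c) (by fun_prop),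
    apply_eq_sw (φ := fun t => sw ((comul (R := k)).lTensor C t)
    fun a s => sw s fun b c => F a b c) (by fun_prop)] at key
  simp only [LinearMap.rTensor_tmul, LinearMap.lTensor_tmul] at key
  refine Eq.trans (sw_congr fun a b => ?_) (key.trans (sw_congr fun a b => ?_))
  · rw [apply_eq_sw (φ := fun t => sw (TensorProduct.assoc k C C C (t ⊗ₜ b))
      fun a s => sw s fun b c => F a b c) (by fun_prop)]
    refine sw_congr fun c d => ?_
    rw [TensorProduct.assoc_tmul, sw_tmul _ _ _ (by fun_prop) (by fun_prop),
      sw_tmul _ _ _ (by fun_prop) (by fun_prop)]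
  · rw [sw_tmul _ _ _ (by fun_prop) (by fun_prop)]

theorem sw_counit_left (h : C) (F : C → M) (hF : IsLinearMap k F) :
    (sw (Δ h) fun a b => ε a • F b) = F h := by
  have key := congrArg (fun t => F (TensorProduct.lid k C t))
    (Coalgebra.rTensor_counit_comul (R := k) h)
  rw [apply_eq_sw (φ := fun t => F (TensorProduct.lid k C ((counit (R := k)).rTensor C t)))
    (by fun_prop)] at key
  simpa [hF.map_smul] using key

theorem sw_counit_right (h : C) (F : C → M) (hF : IsLinearMap k F) :
    (sw (Δ h) fun a b => ε b • F a) = F h := by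
  have key := congrArg (fun t => F (TensorProduct.rid k C t))
    (Coalgebra.lTensor_counit_comul (R := k) h)
  rw [apply_eq_sw (φ := fun t => F (TensorProduct.rid k C ((counit (R := k)).lTensor C t)))
    (by fun_prop)] at key
  simpa [hF.map_smul] using key

theorem sw_comul_tmul {D : Type*} [AddCommGroup D] [Module k D] [Coalgebra k D] (c : C) (d : D)
    (F : C ⊗[k] D → C ⊗[k] D → M)
    (h₁ : ∀ a, IsLinearMap k fun c => F a c) (h₂ : ∀ a, IsLinearMap k fun c => F c a) :
    sw (Δ (c ⊗ₜ[k] d)) F =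
      sw (Δ c) fun c₁ c₂ => sw (Δ d) fun d₁ d₂ => F (c₁ ⊗ₜ d₁) (c₂ ⊗ₜ d₂) := by
  rw [TensorProduct.comul_tmul,
    apply_eq_sw (φ := fun t => sw (TensorProduct.AlgebraTensorModule.tensorTensorTensorComm
      k k k k C C D D (t ⊗ₜ Δ d)) F) (by fun_prop)]
  refine sw_congr fun a b => ?_
  rw [apply_eq_sw (φ := fun t => sw (TensorProduct.AlgebraTensorModule.tensorTensorTensorComm
      k k k k C C D D ((a ⊗ₜ b) ⊗ₜ t)) F) (by fun_prop)]
  refine sw_congr fun c d => ?_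
  simp [sw_tmul _ _ _ h₁ h₂]

theorem convMul_eq_sw {A : Type*} [Ring A] [Algebra k A] (f g : WithConv (C →ₗ[k] A)) (c : C) :
    (f * g) c = sw (Δ c) fun a b => f a * g b := by
  rw [LinearMap.convMul_apply,
    apply_eq_sw (φ := fun t => LinearMap.mul' k A (TensorProduct.map f.ofConv g.ofConv t))
      (by fun_prop)]
  rfl

end Coalgebra

/-! ### Antipode identities in Sweedler notation -/

section Hopf

variable {k H M : Type*} [Field k] [Ring H] [AddCommGroup M] [Module k M]

local notation "Δ" => comul (R := k)
local notation "ε" => counit (R := k)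

theorem sw_comul_mul [Bialgebra k H] (a b : H) (F : H → H → M)
    (h₁ : ∀ v, IsLinearMap k fun w => F v w) (h₂ : ∀ w, IsLinearMap k fun v => F v w) :
    sw (Δ (a * b)) F = sw (Δ a) fun a₁ a₂ => sw (Δ b) fun b₁ b₂ => F (a₁ * b₁) (a₂ * b₂) := by
  rw [Bialgebra.comul_mul, apply_eq_sw (φ := fun t => sw (t * Δ b) F) (by fun_prop)]
  refine sw_congr fun v w => ?_
  rw [apply_eq_sw (φ := fun t => sw (v ⊗ₜ w * t) F) (by fun_prop)]
  refine sw_congr fun c d => ?_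
  rw [Algebra.TensorProduct.tmul_mul_tmul, sw_tmul _ _ _ h₁ h₂]

theorem sw_comul_one [Bialgebra k H] (F : H → H → M)
    (h₁ : ∀ v, IsLinearMap k fun w => F v w) (h₂ : ∀ w, IsLinearMap k fun v => F v w) :
    sw (Δ (1 : H)) F = F 1 1 := by
  rw [Bialgebra.comul_one, Algebra.TensorProduct.one_def, sw_tmul _ _ _ h₁ h₂]

variable [HopfAlgebra k H]

theorem sw_antipode_mul (h : H) (F : H → M) (hF : IsLinearMap k F) :
    (sw (Δ h) fun a b => F (antipode k a * b)) = ε h • F 1 := by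
  rw [← hF.map_smul, ← Algebra.algebraMap_eq_smul_one, ← mul_antipode_rTensor_comul_apply h,
    apply_eq_sw (φ := fun t => F (LinearMap.mul' k H ((antipode k).rTensor H t))) (by fun_prop)]
  simp

theorem sw_mul_antipode (h : H) (F : H → M) (hF : IsLinearMap k F) :
    (sw (Δ h) fun a b => F (a * antipode k b)) = ε h • F 1 := by
  rw [← hF.map_smul, ← Algebra.algebraMap_eq_smul_one, ← mul_antipode_lTensor_comul_apply h,
    apply_eq_sw (φ := fun t => F (LinearMap.mul' k H ((antipode k).lTensor H t))) (by fun_prop)]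
  simp

/-- Both sides are convolution inverse to Δ in Hom(H, H ⊗ H), one from the left and one from the
right, so they agree. -/
theorem comul_antipode (h : H) :
    Δ (antipode k h) = TensorProduct.map (antipode k) (antipode k)
      (TensorProduct.comm k H H (Δ h)) := by
  let f : WithConv (H →ₗ[k] H ⊗[k] H) := toConv (comul ∘ₗ antipode k)
  let g : WithConv (H →ₗ[k] H ⊗[k] H) := toConv comul
  let f' : WithConv (H →ₗ[k] H ⊗[k] H) :=
    toConv (TensorProduct.map (antipode k) (antipode k) ∘ₗ
      (TensorProduct.comm k H H).toLinearMap ∘ₗ comul)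
  have hfg : f * g = 1 := by
    ext h
    rw [convMul_eq_sw, LinearMap.convOne_apply]
    change (sw (Δ h) fun a b => Δ (antipode k a) * Δ b) = _
    simp only [← Bialgebra.comul_mul]
    rw [sw_antipode_mul h (fun x => Δ x) (by fun_prop), Bialgebra.comul_one,
      Algebra.algebraMap_eq_smul_one]
  have hgf : g * f' = 1 := by
    ext h
    rw [convMul_eq_sw, LinearMap.convOne_apply]
    change (sw (Δ h) fun a b => Δ a * TensorProduct.map (antipode k) (antipode k)
      (TensorProduct.comm k H H (Δ b))) = _
    calc _ = sw (Δ h) fun a b => sw (Δ a) fun a₁ a₂ => sw (Δ b) fun b₁ b₂ =>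
          (a₁ * antipode k b₂) ⊗ₜ[k] (a₂ * antipode k b₁) := by
          refine sw_congr fun a b => ?_
          rw [apply_eq_sw (φ := fun t => t * TensorProduct.map (antipode k) (antipode k)
            (TensorProduct.comm k H H (Δ b))) (by fun_prop)]
          refine sw_congr fun a₁ a₂ => ?_
          rw [apply_eq_sw (φ := fun t => a₁ ⊗ₜ a₂ * TensorProduct.map (antipode k) (antipode k)
            (TensorProduct.comm k H H t)) (by fun_prop)]
          simp
      _ = sw (Δ h) fun a b => sw (Δ b) fun a₂ b => sw (Δ b) fun b₁ b₂ =>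
          (a * antipode k b₂) ⊗ₜ[k] (a₂ * antipode k b₁) := by
          rw [sw_comul_assoc h (fun a₁ a₂ b => sw (Δ b) fun b₁ b₂ =>
            (a₁ * antipode k b₂) ⊗ₜ[k] (a₂ * antipode k b₁))] <;> intros <;> fun_prop
      _ = sw (Δ h) fun a b => (a * antipode k b) ⊗ₜ[k] 1 := by
          refine sw_congr fun a b => ?_
          rw [← sw_comul_assoc b (fun a₂ b₁ b₂ =>
            (a * antipode k b₂) ⊗ₜ[k] (a₂ * antipode k b₁)) (by fun_prop) (by fun_prop)
              (by fun_prop)]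
          -- The target is expanded by a counit, so that the two sums match term by term and each
          -- term contracts one adjacent pair x S(y). The same device recurs throughout.
          rw [← sw_counit_left b (fun b => (a * antipode k b) ⊗ₜ[k] (1 : H)) (by fun_prop)]
          refine sw_congr fun x y => ?_
          rw [sw_mul_antipode x (fun z => (a * antipode k y) ⊗ₜ[k] z) (by fun_prop)]
      _ = _ := by
          rw [sw_mul_antipode h (fun z => z ⊗ₜ[k] (1 : H)) (by fun_prop),
            Algebra.algebraMap_eq_smul_one, Algebra.TensorProduct.one_def]
  exact congrArg (fun φ : WithConv (H →ₗ[k] H ⊗[k] H) => φ h) (left_inv_eq_right_inv hfg hgf)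

theorem sw_comul_antipode (h : H) (F : H → H → M)
    (h₁ : ∀ v, IsLinearMap k fun w => F v w) (h₂ : ∀ w, IsLinearMap k fun v => F v w) :
    sw (Δ (antipode k h)) F = sw (Δ h) fun a b => F (antipode k b) (antipode k a) := by
  rw [comul_antipode, sw_map _ _ _ _ h₁ h₂, sw_swap _ _ (by fun_prop) (by fun_prop)]

end Hopf

section

variable {k C M V W : Type*} [Field k] [AddCommGroup C] [Module k C] [Coalgebra k C]
  [AddCommGroup M] [Module k M] [AddCommGroup V] [Module k V] [AddCommGroup W] [Module k W]

local notation "Δ" => comul (R := k)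

theorem sw_smul_const (t : V ⊗[k] W) (f : V → W → k) (m : M) :
    (sw t fun v w => f v w • m) = sw t f • m := Finset.sum_smul.symm

/-- Groups the two middle legs of the fourfold comultiplication under one variable, ready to be
contracted. -/
theorem sw_comul_assoc₄ (h : C) (F : C → C → C → C → M)
    (h₁ : ∀ a b c, IsLinearMap k fun x => F x a b c)
    (h₂ : ∀ a b c, IsLinearMap k fun x => F a x b c)
    (h₃ : ∀ a b c, IsLinearMap k fun x => F a b x c)
    (h₄ : ∀ a b c, IsLinearMap k fun x => F a b c x) :
    (sw (Δ h) fun a b => sw (Δ a) fun a₁ a₂ => sw (Δ b) fun b₁ b₂ => F a₁ a₂ b₁ b₂) =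
      sw (Δ h) fun a b => sw (Δ b) fun c d => sw (Δ c) fun c₁ c₂ => F a c₁ c₂ d := by
  simp (disch := fun_prop) only [sw_comul_assoc]

end

/-! ### Coquasitriangular forms: the inverse σ(S·, ·) and the invariance under S ⊗ S -/

namespace IsCoquasitriangular

section Bialgebra

variable {k H M : Type*} [Field k] [Ring H] [AddCommGroup M] [Module k M] [Bialgebra k H]
  {σ : H →ₗ[k] H →ₗ[k] k}

local notation "Δ" => comul (R := k)
local notation "ε" => counit (R := k)

theorem mul_left_apply (hσ : IsCoquasitriangular σ) (h h' g : H) :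
    σ (h * h') g = sw (Δ g) fun a b => σ h a * σ h' b := by
  rw [hσ.mul_left, apply_eq_sw (φ := fun t => LinearMap.mul' k k (TensorProduct.map (σ h) (σ h') t))
    (by fun_prop)]
  simp

theorem mul_right_apply (hσ : IsCoquasitriangular σ) (g h h' : H) :
    σ g (h * h') = sw (Δ g) fun a b => σ a h' * σ b h := by
  rw [hσ.mul_right, apply_eq_sw (φ := fun t => LinearMap.mul' k k
    (TensorProduct.map (σ.flip h') (σ.flip h) t)) (by fun_prop)]
  simp

theorem sw_comm_mul (hσ : IsCoquasitriangular σ) (h g : H) (F : H → M) (hF : IsLinearMap k F) :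
    (sw (Δ h) fun h₁ h₂ => sw (Δ g) fun g₁ g₂ => σ h₁ g₁ • F (h₂ * g₂)) =
      sw (Δ h) fun h₁ h₂ => sw (Δ g) fun g₁ g₂ => σ h₂ g₂ • F (g₁ * h₁) := by
  have key := congrArg (fun φ : WithConv (H ⊗[k] H →ₗ[k] H) => F (φ (h ⊗ₜ g))) hσ.comm
  simp only [convMul_eq_sw] at key
  rw [sw_comul_tmul _ _ _ (by fun_prop) (by fun_prop),
    sw_comul_tmul _ _ _ (by fun_prop) (by fun_prop)] at key
  simpa [hF.map_sw, hF.map_smul, ← Algebra.commutes, ← Algebra.smul_def] using key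

end Bialgebra

section Hopf

variable {k H M : Type*} [Field k] [Ring H] [AddCommGroup M] [Module k M] [HopfAlgebra k H]
  {σ : H →ₗ[k] H →ₗ[k] k}

local notation "Δ" => comul (R := k)
local notation "ε" => counit (R := k)
local notation "S" => antipode k

theorem sw_mul_antipode_left (hσ : IsCoquasitriangular σ) (h g : H) :
    (sw (Δ h) fun h₁ h₂ => sw (Δ g) fun g₁ g₂ => σ h₁ g₁ * σ (S h₂) g₂) = ε h * ε g := by
  simp only [← hσ.mul_left_apply]
  rw [sw_mul_antipode h (fun x => σ x g) (by fun_prop), hσ.one_left, smul_eq_mul]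

theorem sw_antipode_antipode_mul (hσ : IsCoquasitriangular σ) (h g : H) :
    (sw (Δ h) fun h₁ h₂ => sw (Δ g) fun g₁ g₂ => σ (S h₁) (S g₁) * σ (S h₂) g₂) = ε h * ε g := by
  rw [sw_comm]
  calc _ = sw (Δ g) fun g₁ g₂ => σ (S h) (S g₁ * g₂) := by
        refine sw_congr fun g₁ g₂ => ?_
        rw [hσ.mul_right_apply, sw_comul_antipode _ _ (by fun_prop) (by fun_prop)]
        simp only [mul_comm]
    _ = _ := by
        rw [sw_antipode_mul g (fun x => σ (S h) x) (by fun_prop), hσ.one_right, counit_antipode,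
          smul_eq_mul, mul_comm]

/-- Since σ is assumed invertible, it is enough that σ(S·, ·) is a one-sided inverse. -/
theorem inverse_toConv_lift (hσ : IsCoquasitriangular σ) :
    Ring.inverse (toConv (TensorProduct.lift σ)) = toConv (TensorProduct.lift (σ ∘ₗ S)) := by
  refine left_inv_eq_right_inv (Ring.inverse_mul_cancel _ hσ.isUnit) ?_
  ext h g
  change (_ * _ : WithConv (H ⊗[k] H →ₗ[k] k)) (h ⊗ₜ g) = _
  rw [convMul_eq_sw, sw_comul_tmul _ _ _ (by fun_prop) (by fun_prop)]
  simpa using (hσ.sw_mul_antipode_left h g).trans (mul_comm _ _)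

theorem convInv_apply (hσ : IsCoquasitriangular σ) (h g : H) : convInv σ h g = σ (S h) g := by
  rw [convInv, hσ.inverse_toConv_lift]
  rfl

/-- By multiplicativity in the second variable σ(S·, S·) is left inverse to σ⁻¹ = σ(S·, ·), while σ
is right inverse to it; hence the two coincide. -/
theorem apply_antipode_antipode (hσ : IsCoquasitriangular σ) (h g : H) : σ (S h) (S g) = σ h g := by
  have h₁ : toConv (TensorProduct.lift (σ.compl₁₂ S S)) *
      Ring.inverse (toConv (TensorProduct.lift σ)) = 1 := by
    rw [hσ.inverse_toConv_lift]
    ext h g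
    change (_ * _ : WithConv (H ⊗[k] H →ₗ[k] k)) (h ⊗ₜ g) = _
    rw [convMul_eq_sw, sw_comul_tmul _ _ _ (by fun_prop) (by fun_prop)]
    simpa using (hσ.sw_antipode_antipode_mul h g).trans (mul_comm _ _)
  exact congrArg (fun φ : WithConv (H ⊗[k] H →ₗ[k] k) => φ (h ⊗ₜ g))
    (left_inv_eq_right_inv h₁ (Ring.inverse_mul_cancel _ hσ.isUnit))

end Hopf

end IsCoquasitriangular

/-! ### The Drinfeld functional and bijectivity of the antipode -/

section Drinfeld

variable {k H M : Type*} [Field k] [Ring H] [AddCommGroup M] [Module k M] [HopfAlgebra k H]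

local notation "Δ" => comul (R := k)
local notation "ε" => counit (R := k)
local notation "S" => antipode k

/-- The functional `y ↦ σ(y₁, S(y₂))`, for which `y₁ v(y₂) = v(y₁) S²(y₂)`. -/
def drinfeld (σ : H →ₗ[k] H →ₗ[k] k) : H →ₗ[k] k := TensorProduct.lift (σ.compl₂ S) ∘ₗ comul

/-- The convolution inverse `y ↦ σ(S²(y₁), y₂)` of `drinfeld σ`. -/
def drinfeldInv (σ : H →ₗ[k] H →ₗ[k] k) : H →ₗ[k] k := TensorProduct.lift (σ ∘ₗ S ∘ₗ S) ∘ₗ comul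

theorem drinfeld_apply (σ : H →ₗ[k] H →ₗ[k] k) (y : H) :
    drinfeld σ y = sw (Δ y) fun a b => σ a (S b) :=
  (sw_eq_lift (Δ y) (σ.compl₂ S)).symm

theorem drinfeldInv_apply (σ : H →ₗ[k] H →ₗ[k] k) (y : H) :
    drinfeldInv σ y = sw (Δ y) fun a b => σ (S (S a)) b :=
  (sw_eq_lift (Δ y) (σ ∘ₗ S ∘ₗ S)).symm

theorem sw_antipode_mul_antipode_antipode (h : H) (F : H → M) (hF : IsLinearMap k F) :
    (sw (Δ h) fun a b => F (S (S b) * S a)) = ε h • F 1 := by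
  simp only [← antipode_mul_antidistrib]
  rw [sw_mul_antipode h (fun x => F (S x)) (by fun_prop), antipode_one]

variable {σ : H →ₗ[k] H →ₗ[k] k}

namespace IsCoquasitriangular

/-- This is the commutation law of σ for the pair y₁, S(y₂). On one side the two middle legs cancel
inside the product, and the outer legs form v; on the other side the middle legs form v. -/
theorem sw_drinfeld_smul_antipode_mul (hσ : IsCoquasitriangular σ) (y : H) (F : H → M)
    (hF : IsLinearMap k F) :
    (sw (Δ y) fun a b => sw (Δ b) fun b c => drinfeld σ b • F (S c * a)) = drinfeld σ y • F 1 := by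
  have key := sw_congr (t := Δ y) fun a b => hσ.sw_comm_mul a (S b) F hF
  simp (disch := fun_prop) only [sw_comul_antipode] at key
  rw [sw_comul_assoc₄ y (fun a₁ a₂ b₁ b₂ => σ a₁ (S b₂) • F (a₂ * S b₁)) (by fun_prop)
    (by fun_prop) (by fun_prop) (by fun_prop),
    sw_comul_assoc₄ y (fun a₁ a₂ b₁ b₂ => σ a₂ (S b₁) • F (S b₂ * a₁)) (by fun_prop)
    (by fun_prop) (by fun_prop) (by fun_prop)] at key
  simp only [sw_smul_const, ← drinfeld_apply] at key
  rw [← key, drinfeld_apply, ← sw_smul_const]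
  refine sw_congr fun a b => ?_
  rw [← sw_counit_left b (fun b => σ a (S b) • F 1) (by fun_prop)]
  refine sw_congr fun c d => ?_
  rw [sw_mul_antipode c (fun x => σ a (S d) • F x) (by fun_prop)]

/-- Multiplying the previous identity on the left by S² of one further leg makes S²(d)S(c) = S(c
S(d)) collapse. -/
theorem sw_drinfeld_right (hσ : IsCoquasitriangular σ) (y : H) (F : H → M) (hF : IsLinearMap k F) :
    (sw (Δ y) fun a b => drinfeld σ b • F a) = sw (Δ y) fun a b => drinfeld σ a • F (S (S b)) := by
  have key := sw_congr (t := Δ y) fun c d =>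
    hσ.sw_drinfeld_smul_antipode_mul c (fun x => F (S (S d) * x)) (by fun_prop)
  simp only [mul_one, ← mul_assoc] at key
  rw [← key, sw_comul_assoc y (fun a b d => sw (Δ b) fun b c =>
    drinfeld σ b • F (S (S d) * S c * a)) (by fun_prop) (by fun_prop) (by fun_prop)]
  refine sw_congr fun a s => ?_
  rw [sw_comul_assoc s (fun b c d => drinfeld σ b • F (S (S d) * S c * a)) (by fun_prop)
    (by fun_prop) (by fun_prop), ← sw_counit_right s (fun b => drinfeld σ b • F a) (by fun_prop)]
  refine sw_congr fun b t => ?_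
  rw [sw_antipode_mul_antipode_antipode t (fun x => drinfeld σ b • F (x * a)) (by fun_prop),
      one_mul]

/-- The two pairings combine into σ(·, S(c)d), which collapses. This is invertibility of v before v
is moved to the front. -/
theorem sw_drinfeld_mul_aux (hσ : IsCoquasitriangular σ) (y : H) :
    (sw (Δ y) fun a b => sw (Δ b) fun b c => drinfeld σ b * σ a c) = ε y := by
  calc _ = sw (Δ y) fun a s => sw (Δ s) fun t d => sw (Δ t) fun b c => σ b (S c) * σ a d := by
        refine sw_congr fun a s => sw_congr fun t d => ?_
        exact (congrArg (· * σ a d) (drinfeld_apply σ t)).trans (sw_smul_const (Δ t) (fun b c =>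
            σ b (S c)) (σ a d)).symm
    _ = sw (Δ y) fun t s => sw (Δ s) fun c d => σ t (S c * d) := by
        rw [← sw_comul_assoc₄ y (fun a b c d => σ b (S c) * σ a d) (by fun_prop) (by fun_prop)
          (by fun_prop) (by fun_prop)]
        refine sw_congr fun t s => ?_
        rw [sw_comm]
        refine sw_congr fun c d => ?_
        rw [hσ.mul_right_apply]
        simp only [mul_comm]
    _ = _ := by
        rw [← sw_counit_right (k := k) y (fun x => ε x) (by fun_prop)]
        refine sw_congr fun t s => ?_
        rw [sw_antipode_mul s (fun x => σ t x) (by fun_prop), hσ.one_right]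

/-- Moving v to the front past y₁ applies S² to that leg, which turns σ(y₁, y₃) into the pairing
that defines `drinfeldInv`. -/
theorem sw_drinfeld_mul_drinfeldInv (hσ : IsCoquasitriangular σ) (y : H) :
    (sw (Δ y) fun a b => drinfeld σ a * drinfeldInv σ b) = ε y := by
  rw [← hσ.sw_drinfeld_mul_aux y]
  simp only [drinfeldInv_apply, ← smul_eq_mul, ← sw_smul]
  rw [← sw_comul_assoc y (fun a b c => drinfeld σ a • σ (S (S b)) c) (by fun_prop) (by fun_prop)
    (by fun_prop), ← sw_comul_assoc y (fun a b c => drinfeld σ b • σ a c) (by fun_prop)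
        (by fun_prop)
    (by fun_prop)]
  refine sw_congr fun a b => ?_
  rw [hσ.sw_drinfeld_right a (fun a => σ a b) (by fun_prop)]

theorem drinfeld_antipode_antipode (hσ : IsCoquasitriangular σ) (y : H) :
    drinfeld σ (S (S y)) = drinfeld σ y := by
  simp (disch := fun_prop) only [drinfeld_apply, sw_comul_antipode, hσ.apply_antipode_antipode]

theorem drinfeldInv_antipode_antipode (hσ : IsCoquasitriangular σ) (y : H) :
    drinfeldInv σ (S (S y)) = drinfeldInv σ y := by
  simp (disch := fun_prop) only [drinfeldInv_apply, sw_comul_antipode, hσ.apply_antipode_antipode]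

theorem isUnit_antipode (hσ : IsCoquasitriangular σ) : IsUnit (S : Module.End k H) := by
  have key (y : H) : (sw (Δ y) fun a b => sw (Δ b) fun b c =>
      drinfeld σ a • drinfeldInv σ c • S (S b)) = y := by
    rw [← sw_comul_assoc y (fun a b c => drinfeld σ a • drinfeldInv σ c • S (S b)) (by fun_prop)
      (by fun_prop) (by fun_prop)]
    calc _ = sw (Δ y) fun a c => sw (Δ a) fun a b => drinfeld σ b • drinfeldInv σ c • a :=
          sw_congr fun a c =>
            (hσ.sw_drinfeld_right a (fun b => drinfeldInv σ c • b) (by fun_prop)).symm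
      _ = sw (Δ y) fun a b => ε b • a := by
          rw [sw_comul_assoc y (fun a b c => drinfeld σ b • drinfeldInv σ c • a) (by fun_prop)
            (by fun_prop) (by fun_prop)]
          refine sw_congr fun a s => ?_
          simp only [smul_smul]
          rw [sw_smul_const, hσ.sw_drinfeld_mul_drinfeldInv]
      _ = y := sw_counit_right y (fun x => x) (by fun_prop)
  -- The candidate inverse of S² is conjugation by v. It is right inverse by `key`, and left inverse
  -- because v and its inverse are S²-invariant; bijectivity of S² then gives that of S.
  let G : H →ₗ[k] H := IsLinearMap.mk' (fun y => sw (Δ y) fun a b => sw (Δ b) fun b c =>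
      drinfeld σ a • drinfeldInv σ c • b) (by fun_prop)
  have hG (y : H) : G y = sw (Δ y) fun a b => sw (Δ b) fun b c =>
      drinfeld σ a • drinfeldInv σ c • b := rfl
  have h₁ (y : H) : S (S (G y)) = y := by
    simpa only [hG, map_sw, map_smul] using key y
  have h₂ (y : H) : G (S (S y)) = y := by
    rw [hG]
    simpa (disch := fun_prop) only [sw_comul_antipode, hσ.drinfeld_antipode_antipode,
      hσ.drinfeldInv_antipode_antipode] using key y
  rw [Module.End.isUnit_iff]
  exact ⟨fun a b hab => by rw [← h₂ a, ← h₂ b, hab], fun y => ⟨S (G y), h₁ y⟩⟩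

end IsCoquasitriangular

end Drinfeld

/-! ### Right comodules, tensor coactions and braidings in Sweedler notation -/

section Comodule

variable {k H M U V W X : Type*} [Field k] [Ring H] [Bialgebra k H] [AddCommGroup M] [Module k M]
  [AddCommGroup U] [Module k U] [AddCommGroup V] [Module k V] [AddCommGroup W] [Module k W]
  [AddCommGroup X] [Module k X]

local notation "Δ" => comul (R := k)
local notation "ε" => counit (R := k)

theorem assoc_rTensor_eq_sw (f : V →ₗ[k] U ⊗[k] X) (t : V ⊗[k] W) :
    TensorProduct.assoc k U X W (f.rTensor W t) =
      sw t fun v w => sw (f v) fun u x => u ⊗ₜ[k] (x ⊗ₜ[k] w) := by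
  rw [apply_eq_sw (φ := fun t => TensorProduct.assoc k U X W (f.rTensor W t)) (by fun_prop)]
  refine sw_congr fun v w => ?_
  rw [LinearMap.rTensor_tmul,
    apply_eq_sw (φ := fun t => TensorProduct.assoc k U X W (t ⊗ₜ w)) (by fun_prop)]
  rfl

theorem lTensor_eq_sw (f : W →ₗ[k] U ⊗[k] X) (t : V ⊗[k] W) :
    f.lTensor V t = sw t fun v w => sw (f w) fun u x => v ⊗ₜ[k] (u ⊗ₜ[k] x) := by
  rw [apply_eq_sw (φ := fun t => f.lTensor V t) (by fun_prop)]
  refine sw_congr fun v w => ?_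
  rw [LinearMap.lTensor_tmul, apply_eq_sw (φ := fun t => v ⊗ₜ[k] t) (by fun_prop)]

theorem IsRightCoaction.sw_assoc {ρ : V →ₗ[k] V ⊗[k] H} (hρ : IsRightCoaction ρ) (v : V)
    (F : V → H → H → M)
    (h₁ : ∀ a b, IsLinearMap k fun c => F c a b) (h₂ : ∀ a b, IsLinearMap k fun c => F a c b)
    (h₃ : ∀ a b, IsLinearMap k fun c => F a b c) :
    (sw (ρ v) fun a g => sw (ρ a) fun b h => F b h g) =
      sw (ρ v) fun a g => sw (Δ g) fun h h' => F a h h' := by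
  have key := congrArg (fun φ => sw (φ v) fun a s => sw s fun b c => F a b c) hρ.coassoc
  simp only [LinearMap.comp_apply, LinearEquiv.coe_coe, assoc_rTensor_eq_sw, lTensor_eq_sw] at key
  simpa (disch := fun_prop) only [sw_sw, sw_tmul] using key

theorem IsRightCoaction.sw_counit {ρ : V →ₗ[k] V ⊗[k] H} (hρ : IsRightCoaction ρ) (v : V)
    (F : V → M) (hF : IsLinearMap k F) : (sw (ρ v) fun a g => ε g • F a) = F v := by
  have key := congrArg (fun φ => F (φ v)) hρ.counit
  simp only [LinearMap.comp_apply, LinearEquiv.coe_coe] at key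
  rw [apply_eq_sw (φ := fun t => F (TensorProduct.rid k V
    (LinearMap.lTensor V (Coalgebra.counit (R := k) (A := H)) t)))
    (by fun_prop)] at key
  simpa [hF.map_smul] using key

theorem tensorCoaction_tmul (ρV : V →ₗ[k] V ⊗[k] H) (ρW : W →ₗ[k] W ⊗[k] H) (v : V) (w : W) :
    tensorCoaction ρV ρW (v ⊗ₜ w) =
      sw (ρV v) fun v₀ v₁ => sw (ρW w) fun w₀ w₁ => (v₀ ⊗ₜ[k] w₀) ⊗ₜ[k] (v₁ * w₁) := by
  simp only [tensorCoaction, LinearMap.comp_apply, map_tmul]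
  rw [apply_eq_sw (φ := fun t => LinearMap.lTensor (V ⊗[k] W) (LinearMap.mul' k H)
    ((tensorTensorTensorComm k V H W H).toLinearMap (t ⊗ₜ ρW w))) (by fun_prop)]
  refine sw_congr fun a b => ?_
  rw [apply_eq_sw (φ := fun t => LinearMap.lTensor (V ⊗[k] W) (LinearMap.mul' k H)
    ((tensorTensorTensorComm k V H W H).toLinearMap ((a ⊗ₜ b) ⊗ₜ t))) (by fun_prop)]
  simp

theorem braiding_tmul (ς : H →ₗ[k] H →ₗ[k] k) (ρV : V →ₗ[k] V ⊗[k] H) (ρW : W →ₗ[k] W ⊗[k] H)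
    (v : V) (w : W) : braiding ς ρV ρW (v ⊗ₜ w) =
      sw (ρV v) fun v₀ v₁ => sw (ρW w) fun w₀ w₁ => ς v₁ w₁ • (w₀ ⊗ₜ[k] v₀) := by
  simp only [braiding, LinearMap.comp_apply, map_tmul]
  rw [apply_eq_sw (φ := fun t => (TensorProduct.rid k (W ⊗[k] V)).toLinearMap (TensorProduct.map
    (TensorProduct.comm k V W).toLinearMap (TensorProduct.lift ς)
    ((tensorTensorTensorComm k V H W H).toLinearMap (t ⊗ₜ ρW w)))) (by fun_prop)]
  refine sw_congr fun a b => ?_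
  rw [apply_eq_sw (φ := fun t => (TensorProduct.rid k (W ⊗[k] V)).toLinearMap (TensorProduct.map
    (TensorProduct.comm k V W).toLinearMap (TensorProduct.lift ς)
    ((tensorTensorTensorComm k V H W H).toLinearMap ((a ⊗ₜ b) ⊗ₜ t)))) (by fun_prop)]
  simp

end Comodule

/-! ### The right adjoint coaction -/

section AdjointCoaction

variable {k H M : Type*} [Field k] [Ring H] [HopfAlgebra k H] [AddCommGroup M] [Module k M]

local notation "Δ" => comul (R := k)
local notation "ε" => counit (R := k)
local notation "S" => antipode k

theorem sw_adjointCoact (h : H) (F : H → H → M)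
    (h₁ : ∀ v, IsLinearMap k fun w => F v w) (h₂ : ∀ w, IsLinearMap k fun v => F v w) :
    sw (adjointCoact k H h) F = sw (Δ h) fun a s => sw (Δ s) fun b c => F b (S a * c) := by
  simp only [adjointCoact, LinearMap.comp_apply, lTensor_eq_sw (comul (R := k)), map_sw]
  simp [sw_sw _ _ _ h₁ h₂, sw_tmul _ _ _ h₁ h₂]

theorem sw_adjointCoact_antipode (h : H) (F : H → H → M)
    (h₁ : ∀ v, IsLinearMap k fun w => F v w) (h₂ : ∀ w, IsLinearMap k fun v => F v w) :
    sw (adjointCoact k H (S h)) F =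
      sw (Δ h) fun a s => sw (Δ s) fun b c => F (S b) (S (S c) * S a) := by
  simp (disch := fun_prop) only [sw_adjointCoact, sw_comul_antipode, sw_comul_assoc]

/-- The coaction of `x` stays packed: since S reverses products, the outer legs of `y` enclose x₍₁₎.
-/
theorem sw_adjointCoact_mul (x y : H) (F : H → H → M)
    (h₁ : ∀ v, IsLinearMap k fun w => F v w) (h₂ : ∀ w, IsLinearMap k fun v => F v w) :
    sw (adjointCoact k H (x * y)) F =
      sw (adjointCoact k H x) fun x₀ x₁ => sw (Δ y) fun a s => sw (Δ s) fun b c =>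
        F (x₀ * b) (S a * (x₁ * c)) := by
  simp (disch := fun_prop) only [sw_adjointCoact, sw_comul_mul, antipode_mul_antidistrib, mul_assoc]
  refine sw_congr fun a s => ?_
  rw [sw_comm]

theorem isRightCoaction_adjointCoact : IsRightCoaction (adjointCoact k H) where
  coassoc := by
    ext h
    simp only [LinearMap.comp_apply, LinearEquiv.coe_coe, assoc_rTensor_eq_sw, lTensor_eq_sw]
    simp (disch := fun_prop) only [sw_adjointCoact, sw_comul_mul, sw_comul_antipode, sw_comul_assoc]
    -- Moving the splitting of the antipode's argument outwards makes coassociativity applicable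
    -- again.
    have (s c : H) := sw_comm (Δ s) (Δ c) fun b d (a₁ a₂ : H) => sw (Δ d) fun d₁ d₂ =>
      b ⊗ₜ[k] ((S a₂ * d₁) ⊗ₜ[k] (S a₁ * d₂))
    simp only [this]
    simp (disch := fun_prop) only [sw_comul_assoc]
  counit := by
    ext h
    simp only [LinearMap.comp_apply, LinearEquiv.coe_coe, LinearMap.id_apply]
    rw [apply_eq_sw (φ := fun t => TensorProduct.rid k H (LinearMap.lTensor H counit t))
      (by fun_prop)]
    simp only [LinearMap.lTensor_tmul, TensorProduct.rid_tmul]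
    simp (disch := fun_prop) only [sw_adjointCoact, Bialgebra.counit_mul, counit_antipode,
      ← smul_smul, sw_smul, sw_counit_right, sw_counit_left]

theorem adjointCoact_one : adjointCoact k H 1 = 1 ⊗ₜ 1 := by
  rw [← sw_tmul_eq (adjointCoact k H 1)]
  simp (disch := fun_prop) only [sw_adjointCoact, sw_comul_one, antipode_one, mul_one]

theorem sw_adjointCoact_counit (h : H) (F : H → M) (hF : IsLinearMap k F) :
    (sw (adjointCoact k H h) fun a g => ε a • F g) = ε h • F 1 := by
  simp (disch := fun_prop) only [sw_adjointCoact, sw_counit_left, sw_antipode_mul]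

/-- The comultiplication is a morphism of comodules for the adjoint coaction. -/
theorem sw_comul_adjointCoact (h : H) (F : H → H → H → M)
    (h₁ : ∀ a b, IsLinearMap k fun c => F c a b) (h₂ : ∀ a b, IsLinearMap k fun c => F a c b)
    (h₃ : ∀ a b, IsLinearMap k fun c => F a b c) :
    (sw (Δ h) fun u v => sw (adjointCoact k H u) fun a g => sw (adjointCoact k H v) fun b g' =>
        F a b (g * g')) =
      sw (adjointCoact k H h) fun x g => sw (Δ x) fun a b => F a b g := by
  simp (disch := fun_prop) only [sw_adjointCoact, sw_comul_assoc]
  refine sw_congr fun p m => sw_congr fun a m' => ?_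
  rw [← sw_comul_assoc m' (fun q r t => sw (Δ t) fun b w => F a b (S p * q * (S r * w)))
    (by fun_prop) (by fun_prop) (by fun_prop),
    ← sw_counit_left m' (fun t => sw (Δ t) fun b w => F a b (S p * w)) (by fun_prop)]
  refine sw_congr fun z t => ?_
  have := sw_mul_antipode z (fun x => sw (Δ t) fun b w => F a b (S p * x * w)) (by fun_prop)
  simpa only [mul_assoc, one_mul] using this

end AdjointCoaction

/-! ### The two right actions ◁ and ◂ of H on itself defined by σ -/

section Actions

variable {k H M : Type*} [Field k] [Ring H] [HopfAlgebra k H] [AddCommGroup M] [Module k M]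

local notation "Δ" => comul (R := k)
local notation "ε" => counit (R := k)
local notation "S" => antipode k
local notation "ρ" => adjointCoact k H

/-- `a ⊗ b ↦ σ(a₍₁₎, b) a₍₀₎`, for the adjoint coaction. -/
def adjointAct (σ : H →ₗ[k] H →ₗ[k] k) : H →ₗ[k] H →ₗ[k] H :=
  LinearMap.mk₂ k (fun a b => sw (ρ a) fun x g => σ g b • x)
    (fun a a' b => (show IsLinearMap k fun a => sw (ρ a) fun x g =>
        σ g b • x by fun_prop).map_add a a')
    (fun c a b => (show IsLinearMap k fun a => sw (ρ a) fun x g =>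
        σ g b • x by fun_prop).map_smul c a)
    (fun a b b' => (show IsLinearMap k fun b => sw (ρ a) fun x g =>
        σ g b • x by fun_prop).map_add b b')
    (fun c a b => (show IsLinearMap k fun b => sw (ρ a) fun x g =>
        σ g b • x by fun_prop).map_smul c b)

/-- `a ⊗ g ↦ σ(a₂, g) a₁`. -/
def regularAct (σ : H →ₗ[k] H →ₗ[k] k) : H →ₗ[k] H →ₗ[k] H :=
  LinearMap.mk₂ k (fun a b => sw (Δ a) fun x g => σ g b • x)
    (fun a a' b => (show IsLinearMap k fun a => sw (Δ a) fun x g =>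
        σ g b • x by fun_prop).map_add a a')
    (fun c a b => (show IsLinearMap k fun a => sw (Δ a) fun x g =>
        σ g b • x by fun_prop).map_smul c a)
    (fun a b b' => (show IsLinearMap k fun b => sw (Δ a) fun x g =>
        σ g b • x by fun_prop).map_add b b')
    (fun c a b => (show IsLinearMap k fun b => sw (Δ a) fun x g =>
        σ g b • x by fun_prop).map_smul c b)

variable {σ : H →ₗ[k] H →ₗ[k] k}

theorem adjointAct_apply (a b : H) : adjointAct σ a b = sw (ρ a) fun x g => σ g b • x := rfl

theorem regularAct_apply (a b : H) : regularAct σ a b = sw (Δ a) fun x g => σ g b • x := rfl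

/-- The order reversal in σ(g, bb') = σ(g₂, b) σ(g₁, b') is what makes pairing with a right coaction
a right action. -/
theorem IsCoquasitriangular.adjointAct_mul (hσ : IsCoquasitriangular σ) (a b b' : H) :
    adjointAct σ a (b * b') = adjointAct σ (adjointAct σ a b) b' := by
  rw [adjointAct_apply a b]
  rw [IsLinearMap.map_sw (f := fun x => adjointAct σ x b') (by fun_prop)]
  simp only [map_smul, LinearMap.smul_apply, adjointAct_apply, ← sw_smul]
  rw [isRightCoaction_adjointCoact.sw_assoc a (fun y g h => σ h b • σ g b' • y) (by fun_prop)
    (by fun_prop) (by fun_prop)]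
  refine sw_congr fun x g => ?_
  rw [hσ.mul_right_apply, ← sw_smul_const]
  simp only [smul_smul, mul_comm]

theorem IsCoquasitriangular.adjointAct_one (hσ : IsCoquasitriangular σ) (a : H) :
    adjointAct σ a 1 = a := by
  simp only [adjointAct_apply, hσ.one_right]
  exact isRightCoaction_adjointCoact.sw_counit a (fun x => x) (by fun_prop)

theorem IsCoquasitriangular.regularAct_mul (hσ : IsCoquasitriangular σ) (a b b' : H) :
    regularAct σ a (b * b') = regularAct σ (regularAct σ a b) b' := by
  rw [regularAct_apply a b,
    IsLinearMap.map_sw (f := fun x => regularAct σ x b') (by fun_prop)]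
  simp only [map_smul, LinearMap.smul_apply, regularAct_apply, ← sw_smul]
  rw [sw_comul_assoc a (fun y g h => σ h b • σ g b' • y) (by fun_prop)
    (by fun_prop) (by fun_prop)]
  refine sw_congr fun x g => ?_
  rw [hσ.mul_right_apply, ← sw_smul_const]
  simp only [smul_smul, mul_comm]

theorem IsCoquasitriangular.regularAct_one (hσ : IsCoquasitriangular σ) (a : H) :
    regularAct σ a 1 = a := by
  simp only [regularAct_apply, hσ.one_right]
  exact sw_counit_right a (fun x => x) (by fun_prop)

theorem IsCoquasitriangular.one_regularAct (hσ : IsCoquasitriangular σ) (g : H) :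
    regularAct σ 1 g = ε g • 1 := by
  rw [regularAct_apply, sw_comul_one _ (by fun_prop) (by fun_prop), hσ.one_left]

theorem counit_regularAct (a g : H) : ε (regularAct σ a g) = σ a g := by
  simp only [regularAct_apply, map_sw, map_smul, smul_eq_mul, mul_comm]
  exact sw_counit_left a (fun x => σ x g) (by fun_prop)

/-- Multiplicativity of σ in its first variable makes H a module algebra under ◂. -/
theorem IsCoquasitriangular.mul_regularAct (hσ : IsCoquasitriangular σ) (a b g : H) :
    regularAct σ (a * b) g = sw (Δ g) fun g₁ g₂ => regularAct σ a g₁ * regularAct σ b g₂ := by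
  simp (disch := fun_prop) only [regularAct_apply, sw_comul_mul, hσ.mul_left_apply]
  simp only [← sw_smul_const]
  have (g₁ g₂ : H) : (sw (Δ a) fun x g => σ g g₁ • x) * (sw (Δ b) fun x g => σ g g₂ • x) =
      sw (Δ a) fun a₁ a₂ => sw (Δ b) fun b₁ b₂ => (σ a₂ g₁ * σ b₂ g₂) • (a₁ * b₁) := by
    rw [IsLinearMap.map_sw (f := fun t => t * sw (Δ b) fun x g => σ g g₂ • x) (by fun_prop)]
    refine sw_congr fun a₁ a₂ => ?_
    rw [IsLinearMap.map_sw (f := fun t => (σ a₂ g₁ • a₁) * t) (by fun_prop)]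
    simp only [smul_mul_smul_comm]
  simp only [this]
  rw [sw_comm (Δ g) (Δ a)]
  refine sw_congr fun a₁ a₂ => ?_
  rw [sw_comm]

/-- The extra pairing cancels the leg S(p) in the adjoint coaction, since c · S(p) · r collapses to
r. This factorisation isolates the braiding in the comultiplication of a product. -/
theorem IsCoquasitriangular.sw_smul_adjointAct (hσ : IsCoquasitriangular σ) (a g : H) :
    (sw (Δ a) fun c x => sw (Δ g) fun g₁ g₂ => σ c g₁ • adjointAct σ x g₂) = regularAct σ a g := by
  simp (disch := fun_prop) only [adjointAct_apply, sw_adjointCoact, ← sw_smul, smul_smul]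
  calc _ = sw (Δ a) fun c x => sw (Δ x) fun p s => sw (Δ s) fun q r => σ (c * (S p * r)) g • q := by
        refine sw_congr fun c x => ?_
        rw [sw_comm]
        refine sw_congr fun p s => ?_
        rw [sw_comm]
        refine sw_congr fun q r => ?_
        rw [sw_smul_const, hσ.mul_left_apply]
    _ = sw (Δ a) fun z s => sw (Δ s) fun q r => ε z • σ r g • q := by
        rw [← sw_comul_assoc a (fun c p s => sw (Δ s) fun q r => σ (c * (S p * r)) g • q)
          (by fun_prop) (by fun_prop) (by fun_prop)]
        refine sw_congr fun z s => ?_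
        rw [sw_comm]
        refine sw_congr fun q r => ?_
        have := sw_mul_antipode (k := k) z (fun x => σ (x * r) g • q) (by fun_prop)
        simpa only [mul_assoc, one_mul] using this
    _ = _ := by
        simp only [sw_smul]
        exact sw_counit_left a (fun s => sw (Δ s) fun q r => σ r g • q) (by fun_prop)

/-- A map which is colinear for the adjoint coaction commutes with `adjointAct`. -/
theorem map_adjointAct (f : H →ₗ[k] H)
    (hf : ∀ a : H, ρ (f a) = sw (ρ a) fun x g => f x ⊗ₜ[k] g) (a b : H) :
    f (adjointAct σ a b) = adjointAct σ (f a) b := by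
  rw [adjointAct_apply, adjointAct_apply, hf, map_sw, sw_sw _ _ _ (by fun_prop) (by fun_prop)]
  refine sw_congr fun x g => ?_
  rw [sw_tmul _ _ _ (by fun_prop) (by fun_prop), map_smul]

/-- The Yetter–Drinfeld condition for ρ and ◁: it is the commutation law of σ applied to a₍₁₎ and
`b`. -/
theorem IsCoquasitriangular.sw_adjointCoact_adjointAct_mul (hσ : IsCoquasitriangular σ) (a b : H)
    (F : H → H → M)
    (h₁ : ∀ v, IsLinearMap k fun w => F v w) (h₂ : ∀ w, IsLinearMap k fun v => F v w) :
    (sw (Δ b) fun b₁ b₂ => sw (ρ (adjointAct σ a b₂)) fun c g => F c (b₁ * g)) =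
      sw (ρ a) fun a₀ a₁ => sw (Δ b) fun b₁ b₂ => F (adjointAct σ a₀ b₁) (a₁ * b₂) := by
  calc _ = sw (ρ a) fun x w => sw (Δ w) fun w₁ w₂ => sw (Δ b) fun b₁ b₂ =>
        σ w₂ b₂ • F x (b₁ * w₁) := by
        rw [← isRightCoaction_adjointCoact.sw_assoc a (fun x h g => sw (Δ b) fun b₁ b₂ =>
          σ g b₂ • F x (b₁ * h)) (by fun_prop) (by fun_prop) (by fun_prop)]
        calc _ = sw (Δ b) fun b₁ b₂ => sw (ρ a) fun x g => sw (ρ x) fun y h =>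
              σ g b₂ • F y (b₁ * h) := by
              refine sw_congr fun b₁ b₂ => ?_
              have hF : IsLinearMap k fun t => sw (ρ t) fun c g => F c (b₁ * g) := by fun_prop
              rw [adjointAct_apply, hF.map_sw]
              exact sw_congr fun x g => (hF.map_smul _ _).trans (sw_smul _ _ _).symm
          _ = sw (ρ a) fun x g => sw (Δ b) fun b₁ b₂ => sw (ρ x) fun y h =>
              σ g b₂ • F y (b₁ * h) := sw_comm _ _ _
          _ = _ := sw_congr fun x g => sw_comm _ _ _
    _ = sw (ρ a) fun x w => sw (Δ w) fun w₁ w₂ => sw (Δ b) fun b₁ b₂ =>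
        σ w₁ b₁ • F x (w₂ * b₂) :=
        sw_congr fun x w => (hσ.sw_comm_mul w b (F x) (by fun_prop)).symm
    _ = _ := by
        rw [← isRightCoaction_adjointCoact.sw_assoc a (fun x h g => sw (Δ b) fun b₁ b₂ =>
          σ h b₁ • F x (g * b₂)) (by fun_prop) (by fun_prop) (by fun_prop)]
        refine sw_congr fun x g => ?_
        rw [sw_comm]
        refine sw_congr fun b₁ b₂ => ?_
        rw [adjointAct_apply, IsLinearMap.map_sw (f := fun t => F t (g * b₂)) (by fun_prop)]
        exact sw_congr fun c h => ((h₂ _).map_smul _ _).symm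

/-- The Yetter–Drinfeld condition solved for the coaction of a ◁ b, by multiplying with an antipode
on the left. -/
theorem IsCoquasitriangular.sw_adjointCoact_adjointAct (hσ : IsCoquasitriangular σ) (a b : H)
    (F : H → H → M)
    (h₁ : ∀ v, IsLinearMap k fun w => F v w) (h₂ : ∀ w, IsLinearMap k fun v => F v w) :
    sw (ρ (adjointAct σ a b)) F =
      sw (ρ a) fun a₀ a₁ => sw (Δ b) fun b₁ t => sw (Δ t) fun b₂ b₃ =>
        F (adjointAct σ a₀ b₂) (S b₁ * a₁ * b₃) := by
  rw [sw_comm, ← sw_counit_left b (fun t => sw (ρ (adjointAct σ a t)) F) (by fun_prop)]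
  calc _ = sw (Δ b) fun p t => sw (Δ t) fun b₁ b₂ => sw (ρ (adjointAct σ a b₂)) fun c g =>
        F c (S p * (b₁ * g)) := by
        rw [← sw_comul_assoc b (fun p b₁ b₂ => sw (ρ (adjointAct σ a b₂)) fun c g =>
          F c (S p * (b₁ * g))) (by fun_prop) (by fun_prop) (by fun_prop)]
        refine sw_congr fun z t => ?_
        have := sw_antipode_mul z (fun x => sw (ρ (adjointAct σ a t)) fun c g => F c (x * g))
          (by fun_prop)
        simpa only [mul_assoc, one_mul] using this.symm
    _ = _ := by
        refine sw_congr fun p t => ?_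
        simp only [mul_assoc]
        exact hσ.sw_adjointCoact_adjointAct_mul a t (fun c x => F c (S p * x)) (by fun_prop)
          (by fun_prop)

end Actions

/-! ### Product and antipode of the function algebra braided group -/

section FunctionBraidedGroup

variable {k H M : Type*} [Field k] [Ring H] [HopfAlgebra k H] [AddCommGroup M] [Module k M]

local notation "Δ" => comul (R := k)
local notation "ε" => counit (R := k)
local notation "S" => antipode k
local notation "ρ" => adjointCoact k H

variable {σ : H →ₗ[k] H →ₗ[k] k}

theorem functionBraidedGroup_mul_tmul_eq_adjointAct (x y : H) :
    (functionBraidedGroup σ).mul (x ⊗ₜ y) =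
      sw (Δ y) fun a b => adjointAct σ x (S a) * b := by
  simp only [functionBraidedGroup, LinearMap.comp_apply, map_tmul]
  rw [apply_eq_sw (φ := fun t => (TensorProduct.rid k H).toLinearMap
    (TensorProduct.map (LinearMap.mul' k H) (TensorProduct.lift (σ.compl₂ (antipode k)))
      ((tensorTensorTensorComm k H H H H).toLinearMap
        (ρ x ⊗ₜ[k] (TensorProduct.comm k H H).toLinearMap t)))) (by fun_prop)]
  refine sw_congr fun a b => ?_
  rw [apply_eq_sw (φ := fun t => (TensorProduct.rid k H).toLinearMap
    (TensorProduct.map (LinearMap.mul' k H) (TensorProduct.lift (σ.compl₂ (antipode k)))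
      ((tensorTensorTensorComm k H H H H).toLinearMap
        (t ⊗ₜ[k] (TensorProduct.comm k H H).toLinearMap (a ⊗ₜ b))))) (by fun_prop),
    adjointAct_apply, IsLinearMap.map_sw (f := fun t => t * b) (by fun_prop)]
  refine sw_congr fun c d => ?_
  simp

theorem functionBraidedGroup_antipode_apply (y : H) :
    (functionBraidedGroup σ).antipode y = sw (Δ y) fun a b => adjointAct σ (S a) b := by
  simp (disch := fun_prop) only [adjointAct_apply, sw_adjointCoact_antipode]
  simp only [functionBraidedGroup, LinearMap.comp_apply]
  let φ : (H ⊗[k] H) ⊗[k] (H ⊗[k] H) →ₗ[k] H := (TensorProduct.rid k H).toLinearMap ∘ₗ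
    TensorProduct.map (HopfAlgebra.antipode k)
      (TensorProduct.lift σ ∘ₗ
        (LinearMap.mul' k H ∘ₗ
          TensorProduct.map (HopfAlgebra.antipode k ∘ₗ HopfAlgebra.antipode k)
            (HopfAlgebra.antipode k) ∘ₗ
          (TensorProduct.comm k H H).toLinearMap).rTensor H ∘ₗ
        (TensorProduct.assoc k H H H).symm.toLinearMap) ∘ₗ
    (TensorProduct.assoc k H H (H ⊗[k] H)).toLinearMap ∘ₗ
    ((TensorProduct.comm k H H).toLinearMap.rTensor (H ⊗[k] H))
  change φ (TensorProduct.map comul comul (Δ y)) = _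
  have hφ (a b c d : H) : φ ((a ⊗ₜ b) ⊗ₜ (c ⊗ₜ d)) = σ (S (S c) * S a) d • S b := by simp [φ]
  rw [apply_eq_sw (φ := fun t => φ (TensorProduct.map comul comul t)) (by fun_prop)]
  trans sw (Δ y) fun u v => sw (Δ u) fun a b => sw (Δ v) fun c d => σ (S (S c) * S a) d • S b
  · refine sw_congr fun u v => ?_
    rw [map_tmul, apply_eq_sw (φ := fun t => φ (t ⊗ₜ Δ v)) (by fun_prop)]
    refine sw_congr fun a b => ?_
    rw [apply_eq_sw (φ := fun t => φ ((a ⊗ₜ b) ⊗ₜ t)) (by fun_prop)]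
    exact sw_congr fun c d => hφ a b c d
  · simp (disch := fun_prop) only [sw_comul_assoc]

namespace IsCoquasitriangular

/-- The second form of the product. The pairing with S(y₁)-legs is split off, and the commutation
law of σ reverses the remaining product. In this form x enters only through ◂, which interacts well
with products and with Δ. -/
theorem functionBraidedGroup_mul_tmul (hσ : IsCoquasitriangular σ) (x y : H) :
    (functionBraidedGroup σ).mul (x ⊗ₜ y) = sw (ρ y) fun b g => b * regularAct σ x g := by
  rw [functionBraidedGroup_mul_tmul_eq_adjointAct]
  calc _ = sw (Δ y) fun a u => sw (Δ x) fun t r => σ r (S a) •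
        sw (Δ t) fun p q => sw (Δ u) fun c d => σ p c • (q * d) := by
        have h (a b : H) : adjointAct σ x (S a) * b = sw (Δ x) fun t r => sw (Δ t) fun p q =>
            sw (Δ a) fun a₁ a₂ => σ r (S a₁) • σ p a₂ • (q * b) := by
          rw [adjointAct_apply, IsLinearMap.map_sw (f := fun t => t * b) (by fun_prop),
            sw_adjointCoact _ _ (by fun_prop) (by fun_prop),
            sw_comul_assoc x (fun p q r => sw (Δ a) fun a₁ a₂ => σ r (S a₁) • σ p a₂ • (q * b))
              (by fun_prop) (by fun_prop) (by fun_prop)]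
          refine sw_congr fun p s => sw_congr fun q r => ?_
          rw [hσ.mul_left_apply, sw_comul_antipode _ _ (by fun_prop) (by fun_prop), smul_mul_assoc,
            ← sw_smul_const]
          simp only [hσ.apply_antipode_antipode, smul_smul, mul_comm]
        simp only [h, ← sw_smul]
        refine (sw_comm _ _ _).trans (Eq.trans (sw_congr fun t r => ?_) (sw_comm _ _ _).symm)
        refine (sw_comm _ _ _).trans (Eq.trans (sw_congr fun p q => ?_) (sw_comm _ _ _).symm)
        exact sw_comul_assoc y (fun a c d => σ r (S a) • σ p c • (q * d)) (by fun_prop)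
          (by fun_prop) (by fun_prop)
    _ = sw (Δ y) fun a u => sw (Δ x) fun t r => σ r (S a) •
        sw (Δ t) fun p q => sw (Δ u) fun c d => σ q d • (c * p) := by
        refine sw_congr fun a u => sw_congr fun t r => ?_
        exact congrArg _ (hσ.sw_comm_mul t u (fun x => x) (by fun_prop))
    _ = _ := by
        rw [sw_adjointCoact _ _ (by fun_prop) (by fun_prop)]
        refine sw_congr fun a u => ?_
        simp only [← sw_smul]
        rw [sw_comul_assoc x (fun p q r => sw (Δ u) fun c d => σ r (S a) • σ q d • (c * p))
          (by fun_prop) (by fun_prop) (by fun_prop)]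
        have h (b d : H) : b * regularAct σ x (S a * d) = sw (Δ x) fun p s => sw (Δ s) fun q r =>
            σ r (S a) • σ q d • (b * p) := by
          rw [regularAct_apply, IsLinearMap.map_sw (f := fun t => b * t) (by fun_prop)]
          refine sw_congr fun p s => ?_
          rw [hσ.mul_right_apply, mul_smul_comm, ← sw_smul_const]
          simp only [smul_smul, mul_comm]
        simp only [h]
        rw [sw_comm (Δ u)]
        refine sw_congr fun p s => ?_
        rw [sw_comm (Δ u)]

/-- The multiplication of the function algebra braided group is colinear. -/
theorem sw_adjointCoact_functionBraidedGroup_mul (hσ : IsCoquasitriangular σ) (x y : H)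
    (F : H → H → M)
    (h₁ : ∀ v, IsLinearMap k fun w => F v w) (h₂ : ∀ w, IsLinearMap k fun v => F v w) :
    sw (ρ ((functionBraidedGroup σ).mul (x ⊗ₜ y))) F =
      sw (ρ x) fun x₀ x₁ => sw (ρ y) fun y₀ y₁ =>
        F ((functionBraidedGroup σ).mul (x₀ ⊗ₜ y₀)) (x₁ * y₁) := by
  simp only [hσ.functionBraidedGroup_mul_tmul]
  trans sw (ρ y) fun c w => sw (Δ x) fun p m => sw (Δ m) fun d n => sw (Δ n) fun r q =>
    sw (Δ w) fun h g => σ q g • F (c * d) (S p * (h * r))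
  · have h (b g : H) : sw (ρ (b * regularAct σ x g)) F = sw (ρ b) fun c h => sw (Δ x) fun u q =>
        sw (Δ u) fun p s => sw (Δ s) fun d r => σ q g • F (c * d) (S p * (h * r)) := by
      have hF : IsLinearMap k fun t => sw (ρ (b * t)) F := by fun_prop
      rw [regularAct_apply, hF.map_sw, sw_comm (ρ b)]
      refine sw_congr fun u q => ?_
      rw [hF.map_smul, sw_adjointCoact_mul _ _ _ h₁ h₂]
      simp only [← sw_smul]
    rw [IsLinearMap.map_sw (f := fun t => sw (ρ t) F) (by fun_prop)]
    simp only [h]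
    rw [isRightCoaction_adjointCoact.sw_assoc y (fun c h g => sw (Δ x) fun u q =>
        sw (Δ u) fun p s => sw (Δ s) fun d r => σ q g • F (c * d) (S p * (h * r))) (by fun_prop)
        (by fun_prop) (by fun_prop)]
    refine sw_congr fun c w => ?_
    simp (disch := fun_prop) only [sw_comul_assoc]
    refine (sw_comm _ _ _).trans (sw_congr fun p m => ?_)
    refine (sw_comm _ _ _).trans (sw_congr fun d n => ?_)
    exact sw_comm _ _ _
  -- The commutation law of σ turns h·r into q·g, so that S(p)·q·g becomes x₍₁₎ y₍₁₎.
  trans sw (ρ y) fun c w => sw (Δ x) fun p m => sw (Δ m) fun d n => sw (Δ n) fun r q =>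
    sw (Δ w) fun h g => σ r h • F (c * d) (S p * (q * g))
  · refine sw_congr fun c w => sw_congr fun p m => sw_congr fun d n => ?_
    exact (hσ.sw_comm_mul n w (fun z => F (c * d) (S p * z)) (by fun_prop)).symm
  · have h (u q : H) : (sw (k := k) (ρ y) fun y₀ g => F (sw (ρ y₀) fun b h =>
      b * regularAct σ u h) (q * g)) =
        sw (ρ y) fun c w => sw (Δ u) fun d r => sw (Δ w) fun h g => σ r h • F (c * d) (q * g) := by
      trans sw (ρ y) fun y₀ g => sw (ρ y₀) fun c h => sw (Δ u) fun d r =>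
        σ r h • F (c * d) (q * g)
      · refine sw_congr fun y₀ g => ?_
        rw [IsLinearMap.map_sw (f := fun t => F t (q * g)) (by fun_prop)]
        refine sw_congr fun c h => ?_
        have hF : IsLinearMap k fun t => F (c * t) (q * g) := by fun_prop
        rw [regularAct_apply, hF.map_sw]
        exact sw_congr fun _ _ => hF.map_smul _ _
      · rw [isRightCoaction_adjointCoact.sw_assoc y (fun c h g => sw (Δ u) fun d r =>
          σ r h • F (c * d) (q * g)) (by fun_prop) (by fun_prop) (by fun_prop)]
        exact sw_congr fun c w => sw_comm _ _ _
    simp only [h]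
    rw [sw_adjointCoact x _ (by fun_prop) (by fun_prop), sw_comm]
    refine sw_congr fun p s => ?_
    refine Eq.trans (sw_congr fun c w => ?_) (sw_comm _ _ _)
    simp (disch := fun_prop) only [sw_comul_assoc, mul_assoc]

end IsCoquasitriangular

end FunctionBraidedGroup

section

variable {k : Type*} [Field k] {M₁ M₂ M₃ M₄ N₂ N₃ : Type*}
  [AddCommGroup M₁] [AddCommGroup M₂] [AddCommGroup M₃] [AddCommGroup M₄]
  [AddCommGroup N₂] [AddCommGroup N₃]
  [Module k M₁] [Module k M₂] [Module k M₃] [Module k M₄] [Module k N₂] [Module k N₃]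

theorem midMap_tmul (f : M₂ ⊗[k] M₃ →ₗ[k] N₂ ⊗[k] N₃) (a : M₁) (b : M₂) (c : M₃) (d : M₄) :
    midMap f ((a ⊗ₜ b) ⊗ₜ (c ⊗ₜ d)) = sw (f (b ⊗ₜ c)) fun u v => (a ⊗ₜ[k] u) ⊗ₜ[k] (v ⊗ₜ[k] d) := by
  have : midMap f ((a ⊗ₜ b) ⊗ₜ (c ⊗ₜ d)) = (TensorProduct.assoc k M₁ N₂ (N₃ ⊗[k] M₄)).symm
      (a ⊗ₜ TensorProduct.assoc k N₂ N₃ M₄ (f (b ⊗ₜ c) ⊗ₜ d)) := by simp [midMap]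
  rw [this, apply_eq_sw (φ := fun t => (TensorProduct.assoc k M₁ N₂ (N₃ ⊗[k] M₄)).symm
      (a ⊗ₜ TensorProduct.assoc k N₂ N₃ M₄ (t ⊗ₜ d))) (by fun_prop)]
  rfl

end

/-! ### Hopf algebra axioms for the function algebra braided group -/

section FunctionBraidedGroup

variable {k H M : Type*} [Field k] [Ring H] [HopfAlgebra k H] [AddCommGroup M] [Module k M]

local notation "Δ" => comul (R := k)
local notation "ε" => counit (R := k)
local notation "S" => antipode k
local notation "ρ" => adjointCoact k H

variable {σ : H →ₗ[k] H →ₗ[k] k}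

/-- The antipode of the function algebra braided group is colinear. -/
theorem IsCoquasitriangular.sw_adjointCoact_functionBraidedGroup_antipode
    (hσ : IsCoquasitriangular σ) (y : H) (F : H → H → M)
    (h₁ : ∀ v, IsLinearMap k fun w => F v w) (h₂ : ∀ w, IsLinearMap k fun v => F v w) :
    sw (ρ ((functionBraidedGroup σ).antipode y)) F =
      sw (ρ y) fun a g => F ((functionBraidedGroup σ).antipode a) g := by
  have h (a g : H) : F (sw (k := k) (Δ a) fun a b => adjointAct σ (S a) b) g =
      sw (Δ a) fun a b => F (adjointAct σ (S a) b) g :=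
    IsLinearMap.map_sw (f := fun x => F x g) (by fun_prop) _ _
  rw [functionBraidedGroup_antipode_apply,
    IsLinearMap.map_sw (f := fun t => sw (ρ t) F) (by fun_prop)]
  simp (disch := fun_prop) only [hσ.sw_adjointCoact_adjointAct]
  simp (disch := fun_prop) only [sw_adjointCoact_antipode, sw_adjointCoact y,
    functionBraidedGroup_antipode_apply, h, sw_comul_assoc]
  refine sw_congr fun p s => sw_congr fun c t => ?_
  -- The adjacent factors S(r)S²(q) = S(S(q)r) are grouped so that they contract.
  rw [← sw_comul_assoc t (fun q r u => sw (Δ u) fun b d =>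
    F (adjointAct σ (S c) b) (S r * (S (S q) * S p) * d)) (by fun_prop) (by fun_prop)
    (by fun_prop), ← sw_counit_left t (fun t => sw (Δ t) fun b d =>
    F (adjointAct σ (S c) b) (S p * d)) (by fun_prop)]
  refine sw_congr fun z u => ?_
  have := sw_antipode_mul z (fun x => sw (Δ u) fun b d =>
    F (adjointAct σ (S c) b) (S x * S p * d)) (by fun_prop)
  simpa only [antipode_mul_antidistrib, mul_assoc, one_mul, antipode_one] using this

/-- In the second form of the product both bracketings become z₍₀₎ (y₍₀₎ ◂ z₍₁₎) (x ◂ y₍₁₎z₍₂₎): one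
uses the module algebra property of ◂, the other colinearity of the product. -/
theorem IsCoquasitriangular.functionBraidedGroup_mul_assoc (hσ : IsCoquasitriangular σ)
    (x y z : H) :
    (functionBraidedGroup σ).mul ((functionBraidedGroup σ).mul (x ⊗ₜ y) ⊗ₜ z) =
      (functionBraidedGroup σ).mul (x ⊗ₜ (functionBraidedGroup σ).mul (y ⊗ₜ z)) := by
  rw [hσ.functionBraidedGroup_mul_tmul x ((functionBraidedGroup σ).mul (y ⊗ₜ z)),
      hσ.sw_adjointCoact_functionBraidedGroup_mul _ _ _
    (by fun_prop) (by fun_prop), hσ.functionBraidedGroup_mul_tmul _ z]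
  trans sw (ρ z) fun c g => sw (ρ y) fun b h => sw (Δ g) fun g₁ g₂ =>
    c * regularAct σ b g₁ * regularAct σ x (h * g₂)
  · refine sw_congr fun c g => ?_
    have hF : IsLinearMap k fun t => c * regularAct σ t g := by fun_prop
    rw [hσ.functionBraidedGroup_mul_tmul, hF.map_sw]
    refine sw_congr fun b h => ?_
    rw [hσ.mul_regularAct, IsLinearMap.map_sw (f := fun t => c * t) (by fun_prop)]
    simp only [hσ.regularAct_mul, mul_assoc]
  · rw [sw_comm]
    refine sw_congr fun b h => ?_
    have hmul (c g : H) : (functionBraidedGroup σ).mul (b ⊗ₜ c) * regularAct σ x (h * g) =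
        sw (ρ c) fun a l => a * regularAct σ b l * regularAct σ x (h * g) := by
      rw [hσ.functionBraidedGroup_mul_tmul]
      exact IsLinearMap.map_sw (f := fun t => t * regularAct σ x (h * g)) (by fun_prop) _ _
    simp only [hmul]
    exact (isRightCoaction_adjointCoact.sw_assoc z (fun c g₁ g₂ =>
      c * regularAct σ b g₁ * regularAct σ x (h * g₂)) (by fun_prop) (by fun_prop)
      (by fun_prop)).symm

/-- The pairing consumes only the last leg of `x`, so the action passes to the second tensor factor.
-/
theorem sw_comul_regularAct (x g : H) (F : H → H → M)
    (h₁ : ∀ v, IsLinearMap k fun w => F v w) (h₂ : ∀ w, IsLinearMap k fun v => F v w) :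
    sw (Δ (regularAct σ x g)) F = sw (Δ x) fun a b => F a (regularAct σ b g) := by
  have hF : IsLinearMap k fun t => sw (Δ t) F := by fun_prop
  rw [regularAct_apply, hF.map_sw]
  simp only [hF.map_smul, ← sw_smul]
  rw [sw_comul_assoc x (fun a b c => σ c g • F a b) (by fun_prop) (by fun_prop) (by fun_prop)]
  refine sw_congr fun a b => ?_
  rw [regularAct_apply, (h₁ a).map_sw]
  exact sw_congr fun c d => ((h₁ a).map_smul _ _).symm

/-- Since Δ is colinear for ρ, the second form gives Δ(x·y) with second factor (x₂ ◂ g)·y₂.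
Factoring ◂ by `sw_smul_adjointAct` supplies a pairing that rebuilds the product in the first
factor, while the remaining ◁ is the braiding. -/
theorem IsCoquasitriangular.functionBraidedGroup_comul_mul (hσ : IsCoquasitriangular σ)
    (x y : H) (F : H → H → M)
    (h₁ : ∀ v, IsLinearMap k fun w => F v w) (h₂ : ∀ w, IsLinearMap k fun v => F v w) :
    sw (Δ ((functionBraidedGroup σ).mul (x ⊗ₜ y))) F =
      sw (Δ x) fun x₁ x₂ => sw (Δ y) fun y₁ y₂ => sw (ρ x₂) fun a g => sw (ρ y₁) fun b h =>
        σ g h • F ((functionBraidedGroup σ).mul (x₁ ⊗ₜ b)) ((functionBraidedGroup σ).mul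
            (a ⊗ₜ y₂)) := by
  trans sw (Δ x) fun d m => sw (ρ y) fun c g => sw (Δ c) fun a b =>
    F (a * d) (b * regularAct σ m g)
  · rw [hσ.functionBraidedGroup_mul_tmul,
      IsLinearMap.map_sw (f := fun t => sw (Δ t) F) (by fun_prop), sw_comm]
    refine sw_congr fun c g => ?_
    rw [sw_comul_mul _ _ _ h₁ h₂]
    simp (disch := fun_prop) only [sw_comul_regularAct]
    exact sw_comm _ _ _
  trans sw (Δ x) fun d m => sw (Δ y) fun y₁ y₂ => sw (ρ y₁) fun c g =>
    F (c * d) ((functionBraidedGroup σ).mul (regularAct σ m g ⊗ₜ y₂))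
  · refine sw_congr fun d m => ?_
    rw [← sw_comul_adjointCoact y (fun a b g => F (a * d) (b * regularAct σ m g)) (by fun_prop)
      (by fun_prop) (by fun_prop)]
    refine sw_congr fun y₁ y₂ => sw_congr fun a g => ?_
    rw [hσ.functionBraidedGroup_mul_tmul, (h₁ _).map_sw]
    simp only [hσ.regularAct_mul]
  · have h (x₁ x₂ y₁ y₂ : H) : (sw (ρ x₂) fun a g => sw (ρ y₁) fun b h => σ g h •
        F ((functionBraidedGroup σ).mul (x₁ ⊗ₜ b)) ((functionBraidedGroup σ).mul (a ⊗ₜ y₂))) =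
        sw (ρ y₁) fun c g => sw (Δ x₁) fun d r => sw (Δ g) fun g₁ g₂ => σ r g₁ •
          F (c * d) ((functionBraidedGroup σ).mul (adjointAct σ x₂ g₂ ⊗ₜ y₂)) := by
      trans sw (ρ y₁) fun b h => sw (ρ b) fun c g => sw (Δ x₁) fun d r => σ r g •
          F (c * d) ((functionBraidedGroup σ).mul (adjointAct σ x₂ h ⊗ₜ y₂))
      · rw [sw_comm]
        refine sw_congr fun b h => ?_
        have hG (v : H) : IsLinearMap k fun t => F v ((functionBraidedGroup σ).mul (t ⊗ₜ y₂)) := by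
          fun_prop
        trans F ((functionBraidedGroup σ).mul (x₁ ⊗ₜ b))
          ((functionBraidedGroup σ).mul (adjointAct σ x₂ h ⊗ₜ y₂))
        · rw [adjointAct_apply, (hG _).map_sw]
          exact sw_congr fun a g => ((hG _).map_smul _ _).symm
        · rw [hσ.functionBraidedGroup_mul_tmul x₁, (h₂ _).map_sw]
          refine sw_congr fun c g => ?_
          have hK : IsLinearMap k fun t => F (c * t)
            ((functionBraidedGroup σ).mul (adjointAct σ x₂ h ⊗ₜ y₂)) := by fun_prop
          rw [regularAct_apply, hK.map_sw]
          exact sw_congr fun d r => hK.map_smul _ _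
      · rw [isRightCoaction_adjointCoact.sw_assoc y₁ (fun c g h => sw (Δ x₁) fun d r => σ r g •
          F (c * d) ((functionBraidedGroup σ).mul (adjointAct σ x₂ h ⊗ₜ y₂))) (by fun_prop)
          (by fun_prop) (by fun_prop)]
        exact sw_congr fun c g => sw_comm _ _ _
    simp only [h]
    have h' (d m c g y₂ : H) : F (c * d) ((functionBraidedGroup σ).mul (regularAct σ m g ⊗ₜ y₂)) =
        sw (Δ m) fun r x₂ => sw (Δ g) fun g₁ g₂ => σ r g₁ •
          F (c * d) ((functionBraidedGroup σ).mul (adjointAct σ x₂ g₂ ⊗ₜ y₂)) := by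
      have hG : IsLinearMap k fun t => F (c * d) ((functionBraidedGroup σ).mul (t ⊗ₜ y₂)) := by
        fun_prop
      rw [← hσ.sw_smul_adjointAct, hG.map_sw]
      refine sw_congr fun r x₂ => ?_
      rw [hG.map_sw]
      exact sw_congr fun g₁ g₂ => hG.map_smul _ _
    simp only [h']
    refine Eq.trans ?_ (sw_comm _ _ _)
    refine (sw_comm _ _ _).trans (sw_congr fun y₁ y₂ => ?_)
    refine Eq.trans ?_ (sw_comm _ _ _)
    refine (sw_comm _ _ _).trans (sw_congr fun c g => ?_)
    exact (sw_comul_assoc x (fun d r x₂ => sw (Δ g) fun g₁ g₂ => σ r g₁ •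
          F (c * d) ((functionBraidedGroup σ).mul (adjointAct σ x₂ g₂ ⊗ₜ y₂))) (by fun_prop)
          (by fun_prop) (by fun_prop)).symm

/-- Because ◁ is an action, the sum is (S(y₁) ◁ y₂S(y₃)) y₄ = S(y₁)y₂. -/
theorem IsCoquasitriangular.functionBraidedGroup_antipode_left (hσ : IsCoquasitriangular σ)
    (y : H) :
    (sw (Δ y) fun a b => (functionBraidedGroup σ).mul ((functionBraidedGroup σ).antipode a ⊗ₜ b)) =
      ε y • 1 := by
  have h (a b : H) : (functionBraidedGroup σ).mul ((functionBraidedGroup σ).antipode a ⊗ₜ b) =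
      sw (Δ a) fun a c => sw (Δ b) fun b d => adjointAct σ (S a) (c * S b) * d := by
    rw [functionBraidedGroup_antipode_apply, IsLinearMap.map_sw
      (f := fun t => (functionBraidedGroup σ).mul (t ⊗ₜ b)) (by fun_prop)]
    simp only [functionBraidedGroup_mul_tmul_eq_adjointAct, hσ.adjointAct_mul]
  simp only [h]
  rw [sw_comul_assoc₄ y (fun a c b d => adjointAct σ (S a) (c * S b) * d) (by fun_prop)
    (by fun_prop) (by fun_prop) (by fun_prop)]
  trans sw (Δ y) fun a s => S a * s
  · refine sw_congr fun a s => ?_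
    rw [← sw_counit_left (k := k) s (fun s => S a * s) (by fun_prop)]
    refine sw_congr fun z d => ?_
    rw [sw_mul_antipode z (fun x => adjointAct σ (S a) x * d) (by fun_prop), hσ.adjointAct_one]
  · exact sw_antipode_mul y (fun x => x) (by fun_prop)

theorem IsCoquasitriangular.sw_drinfeld_middle (hσ : IsCoquasitriangular σ) (y : H)
    (F : H → H → M)
    (h₁ : ∀ v, IsLinearMap k fun w => F v w) (h₂ : ∀ w, IsLinearMap k fun v => F v w) :
    (sw (Δ y) fun a t => sw (Δ t) fun b u => drinfeld σ b • F a u) =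
      sw (Δ y) fun a t => sw (Δ t) fun b u => drinfeld σ a • F (S (S b)) u := by
  rw [← sw_comul_assoc y (fun a b u => drinfeld σ b • F a u) (by fun_prop) (by fun_prop)
    (by fun_prop), ← sw_comul_assoc y (fun a b u => drinfeld σ a • F (S (S b)) u) (by fun_prop)
    (by fun_prop) (by fun_prop)]
  exact sw_congr fun w u => hσ.sw_drinfeld_right w (fun a => F a u) (by fun_prop)

/-- The two pairings merge into σ(S²(r₃) S(S(z)r₁), g), where S(z)r₁ collapses. Then S(r₂)S²(c) =
S(S(c)r₂) collapses as well, and what is left is the inverse of v. -/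
theorem IsCoquasitriangular.sw_functionBraidedGroup_antipode_mul (hσ : IsCoquasitriangular σ)
    (y : H) :
    (sw (Δ y) fun c t => sw (Δ t) fun z s => sw (Δ s) fun b q =>
      σ (S (S z)) q • ((functionBraidedGroup σ).antipode b * S (S c))) = drinfeldInv σ y • 1 := by
  have h (b c : H) : (functionBraidedGroup σ).antipode b * c = sw (Δ b) fun r u =>
      sw (Δ r) fun r₁ s => sw (Δ s) fun r₂ r₃ => σ (S (S r₃) * S r₁) u • (S r₂ * c) := by
    rw [functionBraidedGroup_antipode_apply, IsLinearMap.map_sw (f := fun t => t * c) (by fun_prop)]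
    refine sw_congr fun r u => ?_
    rw [adjointAct_apply, sw_adjointCoact_antipode _ _ (by fun_prop) (by fun_prop),
      IsLinearMap.map_sw (f := fun t => t * c) (by fun_prop)]
    refine sw_congr fun r₁ s => ?_
    rw [IsLinearMap.map_sw (f := fun t => t * c) (by fun_prop)]
    simp only [smul_mul_assoc]
  simp only [h, ← sw_smul]
  simp (disch := fun_prop) only [sw_comul_assoc]
  trans sw (Δ y) fun c t => sw (Δ t) fun r₂ t => sw (Δ t) fun r₃ g =>
    σ (S (S r₃)) g • (S r₂ * S (S c))
  · refine sw_congr fun c t => ?_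
    rw [← sw_comul_assoc t (fun z r₁ s => sw (Δ s) fun r₂ t => sw (Δ t) fun r₃ g => sw
        (Δ g) fun u q =>
      σ (S (S z)) q • σ (S (S r₃) * S r₁) u • (S r₂ * S (S c))) (by fun_prop) (by fun_prop)
      (by fun_prop), ← sw_counit_left t (fun t => sw (Δ t) fun r₂ t => sw (Δ t) fun r₃ g =>
      σ (S (S r₃)) g • (S r₂ * S (S c))) (by fun_prop)]
    refine sw_congr fun w s => ?_
    have key := sw_antipode_mul w (fun x => sw (Δ s) fun r₂ t => sw (Δ t) fun r₃ g =>
      σ (S (S r₃) * S x) g • (S r₂ * S (S c))) (by fun_prop)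
    simp only [antipode_one, mul_one] at key
    rw [← key]
    refine sw_congr fun z r₁ => sw_congr fun r₂ t => sw_congr fun r₃ g => ?_
    rw [antipode_mul_antidistrib, ← mul_assoc, hσ.mul_left_apply, ← sw_smul_const]
    simp only [smul_smul, mul_comm]
  · rw [← sw_comul_assoc y (fun c r₂ t => sw (Δ t) fun r₃ g =>
      σ (S (S r₃)) g • (S r₂ * S (S c))) (by fun_prop) (by fun_prop) (by fun_prop)]
    trans sw (Δ y) fun w t => ε w • drinfeldInv σ t • (1 : H)
    · refine sw_congr fun w t => ?_
      have key := sw_antipode_mul w (fun x => sw (Δ t) fun r₃ g => σ (S (S r₃)) g • S x)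
        (by fun_prop)
      simp only [antipode_one, antipode_mul_antidistrib] at key
      rw [key, drinfeldInv_apply, sw_smul_const]
    · exact sw_counit_left y (fun t => drinfeldInv σ t • (1 : H)) (by fun_prop)

/-- Colinearity of the antipode and the second form of the product produce a factor v between the
legs of `y`. Moving it to the front past two legs applies S² to them; the rest sums to the inverse
of v, and the two cancel. -/
theorem IsCoquasitriangular.functionBraidedGroup_antipode_right (hσ : IsCoquasitriangular σ)
    (y : H) :
    (sw (Δ y) fun a b => (functionBraidedGroup σ).mul (a ⊗ₜ (functionBraidedGroup σ).antipode b)) =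
      ε y • 1 := by
  have h (a b : H) : (functionBraidedGroup σ).mul (a ⊗ₜ (functionBraidedGroup σ).antipode b) =
      sw (Δ b) fun p s => sw (Δ s) fun b q => sw (Δ a) fun a r => sw (Δ r) fun c d =>
        σ d (S p) • σ c q • ((functionBraidedGroup σ).antipode b * a) := by
    rw [hσ.functionBraidedGroup_mul_tmul,
      hσ.sw_adjointCoact_functionBraidedGroup_antipode _ _ (by fun_prop) (by fun_prop),
      sw_adjointCoact _ _ (by fun_prop) (by fun_prop)]
    refine sw_congr fun p s => sw_congr fun b q => ?_
    rw [regularAct_apply, IsLinearMap.map_sw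
      (f := fun t => (functionBraidedGroup σ).antipode b * t) (by fun_prop)]
    refine sw_congr fun a r => ?_
    rw [hσ.mul_right_apply, mul_smul_comm, ← sw_smul_const]
    simp only [smul_smul, mul_comm]
  trans sw (Δ y) fun a t => sw (Δ t) fun c t => sw (Δ t) fun z s => sw (Δ s) fun b q =>
    drinfeld σ z • σ c q • ((functionBraidedGroup σ).antipode b * a)
  · trans sw (Δ y) fun u v => sw (Δ u) fun a r => sw (Δ r) fun c d => sw (Δ v) fun p s =>
      sw (Δ s) fun b q => σ d (S p) • σ c q • ((functionBraidedGroup σ).antipode b * a)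
    · refine sw_congr fun u v => ?_
      rw [h]
      refine Eq.trans (sw_congr fun p s => ?_) (Eq.trans (sw_comm _ _ _)
        (sw_congr fun a r => sw_comm _ _ _))
      exact (sw_comm _ _ _).trans (sw_congr fun a r => sw_comm _ _ _)
    · simp (disch := fun_prop) only [sw_comul_assoc]
      refine sw_congr fun a t => sw_congr fun c t => ?_
      rw [← sw_comul_assoc t (fun d p s => sw (Δ s) fun b q => σ d (S p) • σ c q •
        ((functionBraidedGroup σ).antipode b * a)) (by fun_prop) (by fun_prop) (by fun_prop)]
      refine sw_congr fun z s => ?_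
      rw [drinfeld_apply]
      simp only [← sw_smul_const]
      exact sw_comm _ _ _
  trans sw (Δ y) fun a t => sw (Δ t) fun c t => drinfeld σ c • sw (Δ t) fun z s => sw
      (Δ s) fun b q =>
    σ (S (S z)) q • ((functionBraidedGroup σ).antipode b * a)
  · refine sw_congr fun a t => ?_
    have := hσ.sw_drinfeld_middle t (fun c s => sw (Δ s) fun b q => σ c q •
      ((functionBraidedGroup σ).antipode b * a)) (by fun_prop) (by fun_prop)
    simpa only [← sw_smul] using this
  have := hσ.sw_drinfeld_middle y (fun a t => sw (Δ t) fun z s => sw (Δ s) fun b q =>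
    σ (S (S z)) q • ((functionBraidedGroup σ).antipode b * a)) (by fun_prop) (by fun_prop)
  rw [this, ← hσ.sw_drinfeld_mul_drinfeldInv y, ← sw_smul_const]
  refine sw_congr fun a t => ?_
  rw [sw_smul, hσ.sw_functionBraidedGroup_antipode_mul, smul_smul]

end FunctionBraidedGroup

/-! ### The function algebra braided group is a Hopf algebra in M^(H,σ) -/

section

variable {k H : Type*} [Field k] [Ring H] [HopfAlgebra k H] {σ : H →ₗ[k] H →ₗ[k] k}

local notation "Δ" => comul (R := k)
local notation "ε" => counit (R := k)
local notation "S" => antipode k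
local notation "ρ" => adjointCoact k H

theorem rTensor_eq_sw {U V W : Type*} [AddCommGroup U] [Module k U] [AddCommGroup V] [Module k V]
    [AddCommGroup W] [Module k W] (f : V →ₗ[k] W) (t : V ⊗[k] U) :
    f.rTensor U t = sw t fun v u => f v ⊗ₜ[k] u := by
  rw [apply_eq_sw (φ := fun t => f.rTensor U t) (by fun_prop)]
  simp

theorem IsCoquasitriangular.isBraidedHopfAlgebra_functionBraidedGroup
    (hσ : IsCoquasitriangular σ) : (functionBraidedGroup σ).IsBraidedHopfAlgebra σ where
  isRightCoaction := isRightCoaction_adjointCoact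
  mul_colinear := by
    refine TensorProduct.ext' fun x y => ?_
    simp only [LinearMap.comp_apply, tensorCoaction_tmul, map_sw, LinearMap.rTensor_tmul]
    exact (sw_tmul_eq _).symm.trans
      (hσ.sw_adjointCoact_functionBraidedGroup_mul x y _ (by fun_prop) (by fun_prop))
  one_colinear := adjointCoact_one
  comul_colinear := by
    ext h
    simp only [LinearMap.comp_apply]
    rw [rTensor_eq_sw, apply_eq_sw (φ := fun t => tensorCoaction (functionBraidedGroup σ).coact
      (functionBraidedGroup σ).coact t) (by fun_prop)]
    simp only [tensorCoaction_tmul]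
    refine (sw_comul_adjointCoact h (fun a b g => (a ⊗ₜ[k] b) ⊗ₜ[k] g) (by fun_prop) (by fun_prop)
      (by fun_prop)).trans (sw_congr fun x g => ?_)
    rw [← IsLinearMap.map_sw (f := fun t => t ⊗ₜ[k] g) (by fun_prop), sw_tmul_eq]
    rfl
  counit_colinear v := by
    have h (c : k) (g : H) : c ⊗ₜ[k] g = c • ((1 : k) ⊗ₜ[k] g) := by
      rw [TensorProduct.smul_tmul', smul_eq_mul, mul_one]
    rw [rTensor_eq_sw]
    simp only [h ((functionBraidedGroup σ).counit _)]
    exact sw_adjointCoact_counit v (fun g => (1 : k) ⊗ₜ[k] g) (by fun_prop)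
  antipode_colinear := by
    ext y
    simp only [LinearMap.comp_apply, rTensor_eq_sw]
    exact (sw_tmul_eq _).symm.trans
      (hσ.sw_adjointCoact_functionBraidedGroup_antipode y _ (by fun_prop) (by fun_prop))
  mul_assoc := TensorProduct.ext_threefold fun x y z => by
    simpa using hσ.functionBraidedGroup_mul_assoc x y z
  one_mul v := by
    rw [hσ.functionBraidedGroup_mul_tmul]
    change (sw (ρ v) fun b g => b * regularAct σ 1 g) = v
    simp only [hσ.one_regularAct, mul_smul_comm, mul_one]
    exact isRightCoaction_adjointCoact.sw_counit v (fun x => x) (by fun_prop)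
  mul_one v := by
    rw [hσ.functionBraidedGroup_mul_tmul]
    change sw (ρ 1) _ = v
    rw [adjointCoact_one, sw_tmul _ _ _ (by fun_prop) (by fun_prop), one_mul, hσ.regularAct_one]
  coassoc := Coalgebra.coassoc
  counit_comul := Coalgebra.rTensor_counit_comul
  comul_counit := Coalgebra.lTensor_counit_comul
  comul_mul := by
    refine TensorProduct.ext' fun x y => ?_
    simp only [LinearMap.comp_apply, map_tmul]
    refine (sw_tmul_eq _).symm.trans
      ((hσ.functionBraidedGroup_comul_mul x y _ (by fun_prop) (by fun_prop)).trans ?_)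
    rw [apply_eq_sw (φ := fun t => TensorProduct.map (functionBraidedGroup σ).mul
      (functionBraidedGroup σ).mul (midMap (braiding σ (functionBraidedGroup σ).coact
        (functionBraidedGroup σ).coact) (t ⊗ₜ (functionBraidedGroup σ).comul y))) (by fun_prop)]
    refine sw_congr fun x₁ x₂ => ?_
    rw [apply_eq_sw (φ := fun t => TensorProduct.map (functionBraidedGroup σ).mul
      (functionBraidedGroup σ).mul (midMap (braiding σ (functionBraidedGroup σ).coact
        (functionBraidedGroup σ).coact) ((x₁ ⊗ₜ x₂) ⊗ₜ t))) (by fun_prop)]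
    refine sw_congr fun y₁ y₂ => ?_
    rw [midMap_tmul, braiding_tmul, map_sw, sw_sw _ _ _ (by fun_prop) (by fun_prop)]
    refine sw_congr fun a g => ?_
    rw [sw_sw _ _ _ (by fun_prop) (by fun_prop)]
    refine sw_congr fun b h => ?_
    rw [TensorProduct.smul_tmul' (σ g h) b a, sw_tmul _ _ _ (by fun_prop) (by fun_prop)]
    simp [TensorProduct.tmul_smul, ← TensorProduct.smul_tmul']
  comul_one := Bialgebra.comul_one
  counit_mul v w := by
    change ε _ = ε v * ε w
    rw [hσ.functionBraidedGroup_mul_tmul, map_sw]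
    simp only [Bialgebra.counit_mul, counit_regularAct]
    rw [mul_comm (ε v), ← hσ.one_right v]
    exact sw_adjointCoact_counit w (fun g => σ v g) (by fun_prop)
  counit_one := Bialgebra.counit_one
  antipode_left v := by
    rw [rTensor_eq_sw, map_sw]
    exact hσ.functionBraidedGroup_antipode_left v
  antipode_right v := by
    rw [apply_eq_sw (φ := fun t => (functionBraidedGroup σ).mul
      ((functionBraidedGroup σ).antipode.lTensor H t)) (by fun_prop)]
    simp only [LinearMap.lTensor_tmul]
    exact hσ.functionBraidedGroup_antipode_right v

end

/-! ### The inverse of the braided antipode -/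

section AntipodeInverse

variable {k H M : Type*} [Field k] [Ring H] [HopfAlgebra k H] [AddCommGroup M] [Module k M]
  {σ : H →ₗ[k] H →ₗ[k] k}

local notation "Δ" => comul (R := k)
local notation "ε" => counit (R := k)
local notation "S" => antipode k
local notation "ρ" => adjointCoact k H

variable (k H) in
/-- The inverse of the antipode (`0` if it is not bijective). -/
def antipodeInv : H →ₗ[k] H := Ring.inverse (antipode k : Module.End k H)

local notation "T" => antipodeInv k H

theorem antipodeInv_antipode (hS : IsUnit (S : Module.End k H)) (x : H) : T (S x) = x :=
  congrArg (fun f : Module.End k H => f x) (Ring.inverse_mul_cancel _ hS)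

theorem antipode_antipodeInv (hS : IsUnit (S : Module.End k H)) (x : H) : S (T x) = x :=
  congrArg (fun f : Module.End k H => f x) (Ring.mul_inverse_cancel _ hS)

theorem antipodeInv_mul (hS : IsUnit (S : Module.End k H)) (x y : H) : T (x * y) = T y * T x := by
  conv_lhs => rw [← antipode_antipodeInv hS x, ← antipode_antipodeInv hS y,
    ← antipode_mul_antidistrib, antipodeInv_antipode hS]

theorem antipodeInv_one (hS : IsUnit (S : Module.End k H)) : T 1 = 1 := by
  conv_lhs => rw [← antipode_one (R := k), antipodeInv_antipode hS]

theorem sw_comul_antipodeInv (hS : IsUnit (S : Module.End k H)) (h : H) (F : H → H → M)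
    (h₁ : ∀ v, IsLinearMap k fun w => F v w) (h₂ : ∀ w, IsLinearMap k fun v => F v w) :
    sw (Δ (T h)) F = sw (Δ h) fun a b => F (T b) (T a) := by
  conv_rhs => rw [← antipode_antipodeInv hS h]
  rw [sw_comul_antipode _ _ (by fun_prop) (by fun_prop)]
  simp only [antipodeInv_antipode hS]

theorem sw_antipodeInv_mul (hS : IsUnit (S : Module.End k H)) (h : H) (F : H → M)
    (hF : IsLinearMap k F) : (sw (Δ h) fun a b => F (T b * a)) = ε h • F 1 := by
  have := sw_antipode_mul h (fun x => F (T x)) (by fun_prop)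
  simpa only [antipodeInv_mul hS, antipodeInv_antipode hS, antipodeInv_one hS] using this

variable (σ) in
/-- The map `y ↦ S⁻¹(y₂) ⊗ y₁`, followed by `adjointAct σ`. -/
def skewAntipode : H →ₗ[k] H :=
  TensorProduct.lift ((adjointAct σ).flip.compl₂ T) ∘ₗ comul

theorem skewAntipode_apply (y : H) :
    skewAntipode σ y = sw (Δ y) fun a b => adjointAct σ (T b) a :=
  (sw_eq_lift (Δ y) ((adjointAct σ).flip.compl₂ T)).symm

/-- By the Yetter–Drinfeld formula the legs T(u)·d become adjacent and contract. Colinearity is what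
lets `map_adjointAct` apply to this map. -/
theorem IsCoquasitriangular.adjointCoact_skewAntipode (hσ : IsCoquasitriangular σ) (y : H) :
    ρ (skewAntipode σ y) = sw (ρ y) fun x g => skewAntipode σ x ⊗ₜ[k] g := by
  have hS := hσ.isUnit_antipode
  have h (a g : H) : (sw (Δ a) fun a b => adjointAct σ (T b) a) ⊗ₜ[k] g =
      sw (Δ a) fun a b => adjointAct σ (T b) a ⊗ₜ[k] g :=
    IsLinearMap.map_sw (f := fun x => x ⊗ₜ[k] g) (by fun_prop) _ _
  rw [← sw_tmul_eq (ρ (skewAntipode σ y)), skewAntipode_apply,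
    IsLinearMap.map_sw (f := fun t => sw (ρ t) fun v w => v ⊗ₜ[k] w) (by fun_prop)]
  simp (disch := fun_prop) only [hσ.sw_adjointCoact_adjointAct]
  simp (disch := fun_prop) only [sw_adjointCoact, sw_comul_antipodeInv hS,
    antipode_antipodeInv hS, skewAntipode_apply, h, sw_comul_assoc]
  trans sw (Δ y) fun a t => sw (Δ t) fun b t => sw (Δ t) fun d t => sw (Δ t) fun u s =>
    sw (Δ s) fun v w => adjointAct σ (T v) b ⊗ₜ[k] (S a * (w * T u) * d)
  · trans sw (Δ y) fun v w => sw (Δ v) fun a t => sw (Δ t) fun b d => sw (Δ w) fun u s =>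
      sw (Δ s) fun v w => adjointAct σ (T v) b ⊗ₜ[k] (S a * (w * T u) * d)
    · refine sw_congr fun v w => Eq.trans ?_ (sw_congr fun a t => sw_comm _ _ _)
      refine Eq.trans (sw_congr fun u s => ?_) (sw_comm _ _ _)
      exact (sw_comm _ _ _).trans (sw_congr fun a t => sw_comm _ _ _)
    · simp (disch := fun_prop) only [sw_comul_assoc]
  refine sw_congr fun a t => sw_congr fun b t => ?_
  rw [← sw_comul_assoc t (fun d u s => sw (Δ s) fun v w =>
    adjointAct σ (T v) b ⊗ₜ[k] (S a * (w * T u) * d)) (by fun_prop) (by fun_prop) (by fun_prop),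
    ← sw_counit_left t (fun s => sw (Δ s) fun v w => adjointAct σ (T v) b ⊗ₜ[k] (S a * w))
    (by fun_prop)]
  refine sw_congr fun z s => ?_
  have := sw_antipodeInv_mul hS z (fun x => sw (Δ s) fun v w =>
    adjointAct σ (T v) b ⊗ₜ[k] (S a * w * x)) (by fun_prop)
  simpa only [mul_assoc, mul_one] using this

/-- The antipode passes through ◁ by colinearity, and S undoes T: the composite is y₃ ◁ T(y₂)y₁ = y.
-/
theorem IsCoquasitriangular.functionBraidedGroup_antipode_skewAntipode
    (hσ : IsCoquasitriangular σ) (y : H) :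
    (functionBraidedGroup σ).antipode (skewAntipode σ y) = y := by
  have hS := hσ.isUnit_antipode
  have h (a b : H) : (functionBraidedGroup σ).antipode (adjointAct σ (T b) a) =
      sw (Δ b) fun c d => adjointAct σ d (T c * a) := by
    rw [map_adjointAct _ (fun a => (sw_tmul_eq _).symm.trans
      (hσ.sw_adjointCoact_functionBraidedGroup_antipode a _ (by fun_prop) (by fun_prop))),
      functionBraidedGroup_antipode_apply, sw_comul_antipodeInv hS _ _ (by fun_prop) (by fun_prop),
      IsLinearMap.map_sw (f := fun x => adjointAct σ x a) (by fun_prop)]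
    simp only [antipode_antipodeInv hS, hσ.adjointAct_mul]
  rw [skewAntipode_apply, map_sw]
  simp only [h]
  rw [← sw_comul_assoc y (fun a c d => adjointAct σ d (T c * a)) (by fun_prop) (by fun_prop)
    (by fun_prop)]
  trans sw (Δ y) fun w d => ε w • d
  · refine sw_congr fun w d => ?_
    rw [sw_antipodeInv_mul hS w (fun x => adjointAct σ d x) (by fun_prop), hσ.adjointAct_one]
  · exact sw_counit_left y (fun x => x) (by fun_prop)

theorem IsCoquasitriangular.skewAntipode_functionBraidedGroup_antipode
    (hσ : IsCoquasitriangular σ) (y : H) :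
    skewAntipode σ ((functionBraidedGroup σ).antipode y) = y := by
  have hS := hσ.isUnit_antipode
  have h (a b : H) : skewAntipode σ (adjointAct σ (S a) b) =
      sw (Δ a) fun c d => adjointAct σ c (S d * b) := by
    rw [map_adjointAct _ hσ.adjointCoact_skewAntipode,
      skewAntipode_apply, sw_comul_antipode _ _ (by fun_prop) (by fun_prop),
      IsLinearMap.map_sw (f := fun x => adjointAct σ x b) (by fun_prop)]
    simp only [antipodeInv_antipode hS, hσ.adjointAct_mul]
  rw [functionBraidedGroup_antipode_apply, map_sw]
  simp only [h]
  rw [sw_comul_assoc y (fun c d b => adjointAct σ c (S d * b)) (by fun_prop) (by fun_prop)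
    (by fun_prop)]
  trans sw (Δ y) fun d w => ε w • d
  · refine sw_congr fun d w => ?_
    rw [sw_antipode_mul w (fun x => adjointAct σ d x) (by fun_prop), hσ.adjointAct_one]
  · exact sw_counit_right y (fun x => x) (by fun_prop)

end AntipodeInverse

/-! ### Invertibility of the braiding -/

section Braiding

variable {k H V W : Type*} [Field k] [Ring H] [HopfAlgebra k H] [AddCommGroup V] [Module k V]
  [AddCommGroup W] [Module k W] {σ : H →ₗ[k] H →ₗ[k] k}

local notation "Δ" => comul (R := k)
local notation "ε" => counit (R := k)
local notation "S" => antipode k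

/-- If the forms `ς` and `τ` satisfy `ς(w₁, v₁) τ(v₂, w₂) = ε(v) ε(w)`, the braiding with respect to
`ς` is left inverse to the one with respect to `τ`. -/
theorem braiding_braiding {ς τ : H →ₗ[k] H →ₗ[k] k}
    (h : ∀ v w : H, (sw (Δ v) fun v₁ v₂ => sw (Δ w) fun w₁ w₂ => ς w₁ v₁ * τ v₂ w₂) = ε v * ε w)
    {ρV : V →ₗ[k] V ⊗[k] H} {ρW : W →ₗ[k] W ⊗[k] H} (hV : IsRightCoaction ρV)
    (hW : IsRightCoaction ρW) (v : V) (w : W) :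
    braiding ς ρW ρV (braiding τ ρV ρW (v ⊗ₜ w)) = v ⊗ₜ w := by
  simp only [braiding_tmul, map_sw, map_smul, ← sw_smul]
  trans sw (ρV v) fun v₀ g => sw (Δ g) fun g₁ g₂ => sw (ρW w) fun w₀ l => sw (Δ l) fun l₁ l₂ =>
    (ς l₁ g₁ * τ g₂ l₂) • (v₀ ⊗ₜ[k] w₀)
  · rw [← hV.sw_assoc v (fun v₀ g₁ g₂ => sw (ρW w) fun w₀ l => sw (Δ l) fun l₁ l₂ =>
      (ς l₁ g₁ * τ g₂ l₂) • (v₀ ⊗ₜ[k] w₀)) (by fun_prop) (by fun_prop) (by fun_prop)]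
    refine sw_congr fun v₀ g => ?_
    rw [sw_comm (ρV v₀)]
    simp only [mul_smul]
    have key := hW.sw_assoc w (fun w₀ l₁ l₂ => sw (ρV v₀) fun v₀ h => ς l₁ h • τ g l₂ •
        (v₀ ⊗ₜ[k] w₀))
      (by fun_prop) (by fun_prop) (by fun_prop)
    refine Eq.trans ?_ (key.trans ?_)
    · refine sw_congr fun w₀ l => sw_congr fun a b => sw_congr fun c d => ?_
      rw [smul_comm]
    · exact sw_congr fun w₀ l => sw_comm _ _ _
  · trans sw (ρV v) fun v₀ g => sw (ρW w) fun w₀ l => ε g • ε l • (v₀ ⊗ₜ[k] w₀)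
    · refine sw_congr fun v₀ g => ?_
      rw [sw_comm]
      refine sw_congr fun w₀ l => ?_
      simp only [sw_smul_const, h, smul_smul]
    · simp only [sw_smul]
      rw [← hV.sw_counit v (fun v => v ⊗ₜ[k] w) (by fun_prop)]
      refine sw_congr fun v₀ g => ?_
      rw [hW.sw_counit w (fun w => v₀ ⊗ₜ[k] w) (by fun_prop)]

theorem IsCoquasitriangular.sw_antipode_mul_left (hσ : IsCoquasitriangular σ) (h g : H) :
    (sw (Δ h) fun h₁ h₂ => sw (Δ g) fun g₁ g₂ => σ (S h₁) g₁ * σ h₂ g₂) = ε h * ε g := by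
  simp only [← hσ.mul_left_apply]
  rw [sw_antipode_mul h (fun x => σ x g) (by fun_prop), hσ.one_left, smul_eq_mul]

/-- The inverse is the braiding for σ; the two orders of composition use the two convolution
identities between σ and σ(S·, ·). -/
theorem IsCoquasitriangular.isUnit_braiding (hσ : IsCoquasitriangular σ)
    {ρV : V →ₗ[k] V ⊗[k] H} (hV : IsRightCoaction ρV) :
    IsUnit (braiding (convInv σ).flip ρV ρV : Module.End k (V ⊗[k] V)) := by
  refine ⟨⟨_, braiding σ ρV ρV, TensorProduct.ext' fun v w => ?_,
    TensorProduct.ext' fun v w => ?_⟩, rfl⟩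
  · refine braiding_braiding (fun v w => ?_) hV hV v w
    rw [← hσ.sw_antipode_mul_left]
    simp only [LinearMap.flip_apply, hσ.convInv_apply]
  · refine braiding_braiding (fun v w => ?_) hV hV v w
    rw [sw_comm, mul_comm, ← hσ.sw_mul_antipode_left]
    simp only [LinearMap.flip_apply, hσ.convInv_apply]

end Braiding

/-! ### The map θ and products in the double of H^cop -/

section Cop

variable {k H M : Type*} [Field k] [Ring H] [HopfAlgebra k H] [AddCommGroup M] [Module k M]
  {σ : H →ₗ[k] H →ₗ[k] k}

local notation "Δ" => comul (R := k)
local notation "ε" => counit (R := k)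
local notation "S" => antipode k
local notation "T" => antipodeInv k H
local notation "κ" => Cop.equiv k H
local notation "ι" => LinearEquiv.symm (Cop.equiv k H)

theorem sw_comul_cop (x : Cop H) (F : Cop H → Cop H → M)
    (h₁ : ∀ v, IsLinearMap k fun w => F v w) (h₂ : ∀ w, IsLinearMap k fun v => F v w) :
    sw (Δ x) F = sw (Δ (κ x)) fun a b => F (ι b) (ι a) := by
  rw [Cop.comul_apply, sw_map _ _ _ _ h₁ h₂, sw_swap _ _ (by fun_prop) (by fun_prop)]
  rfl

theorem antipode_cop_apply (x : Cop H) : antipode k x = ι (T (κ x)) := rfl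

theorem inverse_antipode_cop (hS : IsUnit (S : Module.End k H)) :
    Ring.inverse (antipode k : Module.End k (Cop H)) =
      (ι).toLinearMap ∘ₗ S ∘ₗ (κ).toLinearMap := by
  have h₁ : (antipode k : Module.End k (Cop H)) * ((ι).toLinearMap ∘ₗ S ∘ₗ (κ).toLinearMap) =
      1 := by
    ext x
    simp [Module.End.mul_apply, antipode_cop_apply, antipodeInv_antipode hS]
  have h₂ : ((ι).toLinearMap ∘ₗ S ∘ₗ (κ).toLinearMap) * (antipode k : Module.End k (Cop H)) =
      1 := by
    ext x
    simp [Module.End.mul_apply, antipode_cop_apply, antipode_antipodeInv hS]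
  exact Ring.inverse_unit (⟨_, _, h₁, h₂⟩ : (Module.End k (Cop H))ˣ)

/-- `Cop H` carries only a `HopfAlgebraStruct` instance, so the inverse is verified directly;
flipping both comultiplication and form reduces it to the identities for σ. -/
theorem IsCoquasitriangular.convInv_copForm_apply (hσ : IsCoquasitriangular σ) (a b : Cop H) :
    convInv (copForm σ) a b = σ (S (κ b)) (κ a) := by
  have hl (x y : Cop H) : (TensorProduct.lift (copForm σ)) (x ⊗ₜ y) = σ (κ y) (κ x) := rfl
  let t : WithConv (Cop H ⊗[k] Cop H →ₗ[k] k) :=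
    toConv (TensorProduct.lift ((σ ∘ₗ S).flip.compl₁₂ (κ).toLinearMap (κ).toLinearMap))
  have h₁ : toConv (TensorProduct.lift (copForm σ)) * t = 1 := by
    ext x y
    change (_ * _ : WithConv (Cop H ⊗[k] Cop H →ₗ[k] k)) (x ⊗ₜ y) = _
    rw [convMul_eq_sw, sw_comul_tmul _ _ _ (by fun_prop) (by fun_prop)]
    simp (disch := fun_prop) only [sw_comul_cop]
    refine Eq.trans ?_ ((sw_comm _ _ _).trans (hσ.sw_antipode_mul_left (κ y) (κ x)))
    exact sw_congr fun a b => sw_congr fun c d => mul_comm _ _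
  have h₂ : t * toConv (TensorProduct.lift (copForm σ)) = 1 := by
    ext x y
    change (_ * _ : WithConv (Cop H ⊗[k] Cop H →ₗ[k] k)) (x ⊗ₜ y) = _
    rw [convMul_eq_sw, sw_comul_tmul _ _ _ (by fun_prop) (by fun_prop)]
    simp (disch := fun_prop) only [sw_comul_cop]
    refine Eq.trans ?_ ((sw_comm _ _ _).trans (hσ.sw_mul_antipode_left (κ y) (κ x)))
    exact sw_congr fun a b => sw_congr fun c d => mul_comm _ _
  have : Ring.inverse (toConv (TensorProduct.lift (copForm σ))) = t :=
    Ring.inverse_unit (⟨_, _, h₁, h₂⟩ : (WithConv (Cop H ⊗[k] Cop H →ₗ[k] k))ˣ)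
  rw [convInv, this]
  rfl

theorem theta_cop_apply (hS : IsUnit (S : Module.End k H)) (y : H) :
    Double.theta k (Cop H) (ι y) = sw (Δ y) fun a b => ι (S a) ⊗ₜ[k] ι b := by
  simp only [Double.theta, LinearMap.comp_apply, inverse_antipode_cop hS]
  rw [← sw_tmul_eq (TensorProduct.map _ _ _), sw_map _ _ _ _ (by fun_prop) (by fun_prop)]
  simp only [LinearEquiv.coe_coe]
  rw [sw_swap _ _ (by fun_prop) (by fun_prop), sw_comul_cop _ _ (by fun_prop) (by fun_prop)]
  simp

theorem thetaInv_tmul {K : Type*} [Ring K] [HopfAlgebraStruct k K] (b h : K) :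
    Double.thetaInv k K (b ⊗ₜ h) = ε b • h := by
  simp [Double.thetaInv]

theorem twist_apply {C : Type*} [AddCommGroup C] [Module k C] [Coalgebra k C] (f g : C →ₗ[k] k)
    (c : C) : Double.twist f g c = sw (Δ c) fun a s => sw (Δ s) fun b c => f a • g c • b := by
  simp only [Double.twist, LinearMap.comp_apply]
  rw [apply_eq_sw (φ := fun t => (TensorProduct.lid k C).toLinearMap (TensorProduct.map f
    ((TensorProduct.rid k C).toLinearMap ∘ₗ g.lTensor C ∘ₗ comul) t)) (by fun_prop)]
  refine sw_congr fun a s => ?_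
  simp only [map_tmul, LinearMap.comp_apply, LinearEquiv.coe_coe, TensorProduct.lid_tmul]
  rw [apply_eq_sw (φ := fun t => f a • TensorProduct.rid k C (g.lTensor C t)) (by fun_prop)]
  simp

/-- The counit removes the middle leg b'₂ in the product of the double, leaving only two legs of b',
both paired. -/
theorem thetaInv_mul_tmul {K : Type*} [Ring K] [HopfAlgebraStruct k K] (ς : K →ₗ[k] K →ₗ[k] k)
    (b h b' h' : K) :
    Double.thetaInv k K (Double.mul ς ((b ⊗ₜ h) ⊗ₜ (b' ⊗ₜ h'))) = ε b •
      sw (Δ b') fun c d => sw (Δ h) fun u s => sw (Δ s) fun v w =>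
        (ς c u * convInv ς d w) • (v * h') := by
  have h₁ : Double.thetaInv k K (Double.mul ς ((b ⊗ₜ h) ⊗ₜ (b' ⊗ₜ h'))) =
      ε b • sw (Double.twist (TensorProduct.lift ς) (TensorProduct.lift (convInv ς))
        (b' ⊗ₜ h)) fun u v => ε u • (v * h') := by
    rw [Double.mul, LinearMap.comp_apply, midMap_tmul, map_sw, map_sw, ← sw_smul]
    simp only [map_tmul, LinearMap.mul'_apply, thetaInv_tmul, Bialgebra.counit_mul, mul_smul]
    rfl
  have h₂ : IsLinearMap k fun t : K ⊗[k] K => sw t fun u v => ε u • (v * h') := by fun_prop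
  rw [h₁, twist_apply, h₂.map_sw]
  simp only [h₂.map_sw, h₂.map_smul]
  simp (disch := fun_prop) only [sw_comul_tmul, sw_tmul, TensorProduct.lift.tmul]
  congr 1
  refine sw_congr fun c s => ?_
  rw [← sw_counit_left s (fun d => sw (Δ h) fun u s => sw (Δ s) fun v w =>
    (ς c u * convInv ς d w) • (v * h')) (by fun_prop)]
  simp only [← sw_smul]
  refine (sw_comm _ _ _).trans (sw_congr fun a d => sw_congr fun u s => sw_congr fun v w => ?_)
  simp only [smul_smul]
  congr 1
  ring

/-- With σ₂₁ on H^cop the two pairings become σ(S(h₁), b'₁) and σ(h₃, b'₂) in terms of H. They merge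
into σ(S(h₁)h₃, b'), the pairing with the adjoint coaction. -/
theorem IsCoquasitriangular.thetaInv_mul (hσ : IsCoquasitriangular σ) (b h b' h' : Cop H) :
    Double.thetaInv k (Cop H) (Double.mul (copForm σ) ((b ⊗ₜ h) ⊗ₜ (b' ⊗ₜ h'))) =
      ε b • (ι) (adjointAct σ (κ h) (κ b') * κ h') := by
  refine (thetaInv_mul_tmul (copForm σ) b h b' h').trans (congrArg _ ?_)
  simp only [hσ.convInv_copForm_apply]
  simp (disch := fun_prop) only [sw_comul_cop]
  have hL : IsLinearMap k fun t : H => (ι) (t * κ h') := by fun_prop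
  have hι (x : H) : (ι) (x * κ h') = (ι) x * h' := rfl
  have hκ (x : H) : κ ((ι) x) = x := rfl
  have hς (x y : Cop H) : copForm σ x y = σ (κ y) (κ x) := rfl
  rw [adjointAct_apply, sw_adjointCoact _ _ (by fun_prop) (by fun_prop), hL.map_sw, sw_comm]
  simp only [hκ, hς]
  refine (sw_congr fun u x => sw_comm _ _ _).trans ?_
  rw [sw_comul_assoc (κ h) (fun p q r => sw (Δ (κ b')) fun c d =>
    (σ r d * σ (S p) c) • ((ι) q * h')) (by fun_prop) (by fun_prop) (by fun_prop)]
  refine sw_congr fun p s => ?_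
  rw [hL.map_sw]
  refine sw_congr fun q r => ?_
  rw [hL.map_smul, hσ.mul_left_apply, ← sw_smul_const, hι]
  simp only [mul_comm]

end Cop

/-! ### Radford's structure maps on the coinvariants, followed by ε ⊗ id -/

section Double

variable {k K : Type*} [Field k] [Ring K] [HopfAlgebraStruct k K]

local notation "Δ" => comul (R := k)
local notation "ε" => counit (R := k)
local notation "S" => antipode k

theorem thetaInv_coinvCoact_tmul (b h : K) :
    (Double.thetaInv k K).lTensor K (Double.coinvCoact (b ⊗ₜ h)) =
      sw (Δ h) fun u v => (b * u) ⊗ₜ[k] v := by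
  rw [Double.coinvCoact, LinearMap.comp_apply, rTensor_eq_sw,
    sw_comul_tmul _ _ _ (by fun_prop) (by fun_prop)]
  simp only [map_sw, LinearMap.lTensor_tmul, thetaInv_tmul, Double.proj, LinearMap.mul'_apply]
  rw [sw_comm]
  refine sw_congr fun u v => ?_
  simp only [tmul_smul]
  exact sw_counit_right b (fun b => (b * u) ⊗ₜ[k] v) (by fun_prop)

theorem thetaInv_mul_tmul_eq_counit_smul (ς : K →ₗ[k] K →ₗ[k] k) (b h b' h' : K) :
    Double.thetaInv k K (Double.mul ς ((b ⊗ₜ h) ⊗ₜ (b' ⊗ₜ h'))) = ε b •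
      Double.thetaInv k K (Double.mul ς ((1 ⊗ₜ h) ⊗ₜ (b' ⊗ₜ h'))) := by
  rw [thetaInv_mul_tmul, thetaInv_mul_tmul, Bialgebra.counit_one, one_smul]

theorem thetaInv_toCoinvariants_tmul (ς : K →ₗ[k] K →ₗ[k] k) (b h : K) :
    Double.thetaInv k K (Double.toCoinvariants ς (b ⊗ₜ h)) =
      sw (Δ h) fun u v =>
        Double.thetaInv k K (Double.mul ς ((1 ⊗ₜ u) ⊗ₜ (S (b * v) ⊗ₜ 1))) := by
  rw [Double.toCoinvariants, LinearMap.comp_apply, LinearMap.comp_apply,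
    apply_eq_sw (φ := fun t => Double.thetaInv k K (Double.mul ς (LinearMap.lTensor (K ⊗[k] K)
      (Double.incl k K ∘ₗ antipode k ∘ₗ Double.proj k K) t))) (by fun_prop),
    sw_comul_tmul _ _ _ (by fun_prop) (by fun_prop), sw_comm]
  refine sw_congr fun u v => ?_
  have h (a c : K) : Double.thetaInv k K (Double.mul ς (LinearMap.lTensor (K ⊗[k] K)
      (Double.incl k K ∘ₗ antipode k ∘ₗ Double.proj k K) ((a ⊗ₜ u) ⊗ₜ (c ⊗ₜ v)))) =
      ε a • Double.thetaInv k K (Double.mul ς ((1 ⊗ₜ u) ⊗ₜ (S (c * v) ⊗ₜ 1))) :=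
    thetaInv_mul_tmul_eq_counit_smul ς a u (S (c * v)) 1
  simp only [h]
  exact sw_counit_left b (fun c =>
    Double.thetaInv k K (Double.mul ς ((1 ⊗ₜ u) ⊗ₜ (S (c * v) ⊗ₜ 1)))) (by fun_prop)

theorem thetaInv_coinvComul_tmul (ς : K →ₗ[k] K →ₗ[k] k) (b h : K) :
    TensorProduct.map (Double.thetaInv k K) (Double.thetaInv k K)
        (Double.coinvComul ς (b ⊗ₜ h)) =
      sw (Δ b) fun b₁ b₂ => sw (Δ h) fun h₁ h₂ =>
        Double.thetaInv k K (Double.toCoinvariants ς (b₁ ⊗ₜ h₁)) ⊗ₜ[k]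
          Double.thetaInv k K (Double.toCoinvariants ς (b₂ ⊗ₜ h₂)) := by
  rw [Double.coinvComul, LinearMap.comp_apply,
    apply_eq_sw (φ := fun t => TensorProduct.map (Double.thetaInv k K) (Double.thetaInv k K)
      (TensorProduct.map (Double.toCoinvariants ς) (Double.toCoinvariants ς) t)) (by fun_prop),
    sw_comul_tmul _ _ _ (by fun_prop) (by fun_prop)]
  rfl

/-- The hypothesis says that left multiplication by i(z) is seen only through ε(z); hence the factor
i(π(b₁)) drops out and only S_D remains. -/
theorem thetaInv_coinvAntipode_tmul (ς : K →ₗ[k] K →ₗ[k] k)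
    (hς : ∀ z b h : K, Double.thetaInv k K (Double.mul ς ((z ⊗ₜ 1) ⊗ₜ (b ⊗ₜ h))) =
      ε z • Double.thetaInv k K (b ⊗ₜ h)) (b h : K) :
    Double.thetaInv k K (Double.coinvAntipode ς (b ⊗ₜ h)) =
      Double.thetaInv k K (Double.mul ς ((1 ⊗ₜ S h) ⊗ₜ (S b ⊗ₜ 1))) := by
  have h₁ (z : K) (t : K ⊗[k] K) : Double.thetaInv k K (Double.mul ς ((z ⊗ₜ 1) ⊗ₜ t)) =
      ε z • Double.thetaInv k K t := by
    rw [apply_eq_sw (φ := fun t => Double.thetaInv k K (Double.mul ς ((z ⊗ₜ 1) ⊗ₜ t)))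
      (by fun_prop), apply_eq_sw (φ := fun t => ε z • Double.thetaInv k K t) (by fun_prop)]
    exact sw_congr fun b h => hς z b h
  rw [Double.coinvAntipode, LinearMap.comp_apply, LinearMap.comp_apply,
    apply_eq_sw (φ := fun t => Double.thetaInv k K (Double.mul ς (TensorProduct.map
      (Double.incl k K ∘ₗ Double.proj k K) (Double.antipode ς) t))) (by fun_prop),
    sw_comul_tmul _ _ _ (by fun_prop) (by fun_prop)]
  have h₂ (a b c d : K) : Double.thetaInv k K (Double.mul ς (TensorProduct.map
      (Double.incl k K ∘ₗ Double.proj k K) (Double.antipode ς) ((a ⊗ₜ b) ⊗ₜ (c ⊗ₜ d)))) =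
      ε b • ε a • Double.thetaInv k K (Double.mul ς ((1 ⊗ₜ S d) ⊗ₜ (S c ⊗ₜ 1))) := by
    rw [smul_smul, mul_comm, ← Bialgebra.counit_mul]
    exact h₁ (a * b) _
  simp only [h₂]
  rw [← sw_counit_left (k := k) b (fun c => Double.thetaInv k K (Double.mul ς ((1 ⊗ₜ S h) ⊗ₜ
      (S c ⊗ₜ 1))))
    (by fun_prop)]
  refine sw_congr fun a c => ?_
  exact sw_counit_left h (fun d => ε a • Double.thetaInv k K (Double.mul ς ((1 ⊗ₜ S d) ⊗ₜ
      (S c ⊗ₜ 1))))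
    (by fun_prop)

end Double

/-! ### The structure maps obtained from H^cop, and bijectivity of θ -/

section UnderlineCop

variable {k H M : Type*} [Field k] [Ring H] [HopfAlgebra k H] [AddCommGroup M] [Module k M]
  {σ : H →ₗ[k] H →ₗ[k] k}

local notation "Δ" => comul (R := k)
local notation "ε" => counit (R := k)
local notation "S" => antipode k
local notation "T" => antipodeInv k H
local notation "κ" => Cop.equiv k H
local notation "ι" => LinearEquiv.symm (Cop.equiv k H)

theorem underlineCop_coact (hS : IsUnit (S : Module.End k H)) :
    (underlineCop σ).coact = adjointCoact k H := by
  ext y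
  change TensorProduct.comm k H H (TensorProduct.map (κ).toLinearMap (κ).toLinearMap
    ((Double.thetaInv k (Cop H)).lTensor (Cop H) (Double.coinvCoact
      (Double.theta k (Cop H) ((ι) y))))) = _
  rw [theta_cop_apply hS, IsLinearMap.map_sw (f := fun t => TensorProduct.comm k H H
    (TensorProduct.map (κ).toLinearMap (κ).toLinearMap
      ((Double.thetaInv k (Cop H)).lTensor (Cop H) (Double.coinvCoact t)))) (by fun_prop),
    ← sw_tmul_eq (adjointCoact k H y), sw_adjointCoact _ _ (by fun_prop) (by fun_prop)]
  refine sw_congr fun a b => ?_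
  rw [thetaInv_coinvCoact_tmul, sw_comul_cop _ _ (by fun_prop) (by fun_prop)]
  rw [IsLinearMap.map_sw (f := fun t => TensorProduct.comm k H H
    (TensorProduct.map (κ).toLinearMap (κ).toLinearMap t)) (by fun_prop)]
  rfl

theorem IsCoquasitriangular.underlineCop_mul (hσ : IsCoquasitriangular σ) :
    (underlineCop σ).mul = (functionBraidedGroup σ).mul := by
  refine TensorProduct.ext' fun x y => ?_
  have hS := hσ.isUnit_antipode
  change κ (Double.thetaInv k (Cop H) (Double.mul (copForm σ)
    (Double.theta k (Cop H) ((ι) x) ⊗ₜ Double.theta k (Cop H) ((ι) y)))) = _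
  rw [theta_cop_apply hS, theta_cop_apply hS, functionBraidedGroup_mul_tmul_eq_adjointAct,
    IsLinearMap.map_sw (f := fun t => κ (Double.thetaInv k (Cop H) (Double.mul (copForm σ)
      (t ⊗ₜ sw (Δ y) fun a b => (ι) (S a) ⊗ₜ[k] (ι) b)))) (by fun_prop)]
  have h (a b : H) : κ (Double.thetaInv k (Cop H) (Double.mul (copForm σ)
      (((ι) (S a) ⊗ₜ (ι) b) ⊗ₜ sw (Δ y) fun a b => (ι) (S a) ⊗ₜ[k] (ι) b))) =
      ε a • sw (Δ y) fun c d => adjointAct σ b (S c) * d := by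
    rw [IsLinearMap.map_sw (f := fun t => κ (Double.thetaInv k (Cop H) (Double.mul (copForm σ)
      (((ι) (S a) ⊗ₜ (ι) b) ⊗ₜ t)))) (by fun_prop), ← sw_smul]
    refine sw_congr fun c d => ?_
    rw [hσ.thetaInv_mul, ← counit_antipode (R := k) a]
    rfl
  simp only [h]
  exact sw_counit_left x (fun x => sw (Δ y) fun c d => adjointAct σ x (S c) * d) (by fun_prop)

theorem underlineCop_one : (underlineCop σ).one = 1 := by
  change κ (Double.thetaInv k (Cop H) (1 ⊗ₜ 1)) = 1
  rw [thetaInv_tmul, Bialgebra.counit_one, one_smul]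
  rfl

theorem underlineCop_counit (hS : IsUnit (S : Module.End k H)) :
    (underlineCop σ).counit = counit := by
  ext y
  change ε (Double.theta k (Cop H) ((ι) y)) = _
  rw [theta_cop_apply hS, map_sw, ← sw_counit_left (k := k) y (fun y => ε y) (by fun_prop)]
  refine sw_congr fun a b => ?_
  rw [TensorProduct.counit_tmul, smul_eq_mul, smul_eq_mul, mul_comm, ← counit_antipode (R := k) a]
  rfl

theorem IsCoquasitriangular.thetaInv_toCoinvariants (hσ : IsCoquasitriangular σ) (b h : H) :
    κ (Double.thetaInv k (Cop H) (Double.toCoinvariants (copForm σ) ((ι) b ⊗ₜ (ι) h))) =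
      sw (Δ h) fun u v => adjointAct σ v (T (b * u)) := by
  rw [thetaInv_toCoinvariants_tmul, sw_comul_cop _ _ (by fun_prop) (by fun_prop),
    IsLinearMap.map_sw (f := fun t => κ t) (by fun_prop)]
  refine sw_congr fun u v => ?_
  rw [hσ.thetaInv_mul, Bialgebra.counit_one, one_smul]
  exact mul_one _

/-- This is Π(θ(y)) = θ(y) seen through ε ⊗ id; the argument S(a)u of T collapses. -/
theorem IsCoquasitriangular.sw_thetaInv_toCoinvariants (hσ : IsCoquasitriangular σ) (y : H) :
    (sw (Δ y) fun a b => κ (Double.thetaInv k (Cop H) (Double.toCoinvariants (copForm σ)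
      ((ι) (S a) ⊗ₜ (ι) b)))) = y := by
  simp only [hσ.thetaInv_toCoinvariants]
  rw [← sw_comul_assoc y (fun a u v => adjointAct σ v (T (S a * u))) (by fun_prop) (by fun_prop)
    (by fun_prop)]
  trans sw (Δ y) fun w v => ε w • v
  · refine sw_congr fun w v => ?_
    rw [sw_antipode_mul w (fun x => adjointAct σ v (T x)) (by fun_prop),
      antipodeInv_one hσ.isUnit_antipode, hσ.adjointAct_one]
  · exact sw_counit_left y (fun x => x) (by fun_prop)

/-- Of the four legs of θ(y) after comultiplication, the inner two form θ of one leg of `y`, which Π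
fixes; the outer two give an action ◁ by T(S(a)u), which is the pairing in the braiding for σ₂₁⁻¹.
-/
theorem IsCoquasitriangular.underlineCop_comul (hσ : IsCoquasitriangular σ) :
    (underlineCop σ).comul =
      braiding (convInv σ).flip (adjointCoact k H) (adjointCoact k H) ∘ₗ comul := by
  have hS := hσ.isUnit_antipode
  ext y
  trans sw (Δ y) fun a t => sw (Δ t) fun c b => sw (Δ b) fun u v =>
    adjointAct σ v (T (S a * u)) ⊗ₜ[k] c
  · change TensorProduct.map (κ).toLinearMap (κ).toLinearMap
      (TensorProduct.map (Double.thetaInv k (Cop H)) (Double.thetaInv k (Cop H))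
        (Double.coinvComul (copForm σ) (Double.theta k (Cop H) ((ι) y)))) = _
    rw [theta_cop_apply hS, IsLinearMap.map_sw (f := fun t => TensorProduct.map (κ).toLinearMap
      (κ).toLinearMap (TensorProduct.map (Double.thetaInv k (Cop H)) (Double.thetaInv k (Cop H))
        (Double.coinvComul (copForm σ) t))) (by fun_prop)]
    let p (b h : H) : H :=
      κ (Double.thetaInv k (Cop H) (Double.toCoinvariants (copForm σ) ((ι) b ⊗ₜ (ι) h)))
    trans sw (Δ y) fun a b => sw (Δ a) fun a₁ a₂ => sw (Δ b) fun b₁ b₂ =>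
      p (S a₁) b₂ ⊗ₜ[k] p (S a₂) b₁
    · refine sw_congr fun a b => ?_
      rw [thetaInv_coinvComul_tmul, sw_comul_cop _ _ (by fun_prop) (by fun_prop)]
      simp (disch := fun_prop) only [sw_comul_cop]
      change TensorProduct.map (κ).toLinearMap (κ).toLinearMap (sw (Δ (S a)) _) = _
      rw [sw_comul_antipode _ _ (by fun_prop) (by fun_prop),
        IsLinearMap.map_sw (f := fun t => TensorProduct.map (κ).toLinearMap
          (κ).toLinearMap t) (by fun_prop)]
      refine sw_congr fun a₁ a₂ => ?_
      rw [IsLinearMap.map_sw (f := fun t => TensorProduct.map (κ).toLinearMap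
          (κ).toLinearMap t) (by fun_prop)]
      rfl
    · rw [sw_comul_assoc₄ y (fun a₁ a₂ b₁ b₂ => p (S a₁) b₂ ⊗ₜ[k] p (S a₂) b₁) (by fun_prop)
        (by fun_prop) (by fun_prop) (by fun_prop)]
      refine sw_congr fun a t => sw_congr fun c b => ?_
      rw [← IsLinearMap.map_sw (f := fun x => p (S a) b ⊗ₜ[k] x) (by fun_prop),
        hσ.sw_thetaInv_toCoinvariants c]
      simp only [p, hσ.thetaInv_toCoinvariants]
      exact IsLinearMap.map_sw (f := fun x => x ⊗ₜ[k] c) (by fun_prop) _ _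
  · rw [LinearMap.comp_apply, apply_eq_sw (φ := fun t => braiding (convInv σ).flip
      (adjointCoact k H) (adjointCoact k H) t) (by fun_prop)]
    simp only [braiding_tmul]
    have h (v x c : H) : adjointAct σ v (T x) ⊗ₜ[k] c = sw (adjointCoact k H v) fun w g =>
        convInv σ g x • (w ⊗ₜ[k] c) := by
      rw [adjointAct_apply, IsLinearMap.map_sw (f := fun x => x ⊗ₜ[k] c) (by fun_prop)]
      refine sw_congr fun w g => ?_
      -- Invariance under S ⊗ S turns σ(g, T(x)) into σ(S(g), x) = σ⁻¹(g, x).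
      rw [hσ.convInv_apply, ← hσ.apply_antipode_antipode g (T x), antipode_antipodeInv hS,
        TensorProduct.smul_tmul']
    simp only [h, LinearMap.flip_apply]
    simp (disch := fun_prop) only [sw_adjointCoact, sw_comul_assoc]

theorem IsCoquasitriangular.underlineCop_antipode (hσ : IsCoquasitriangular σ) :
    (underlineCop σ).antipode = skewAntipode σ := by
  have hS := hσ.isUnit_antipode
  ext y
  change κ (Double.thetaInv k (Cop H) (Double.coinvAntipode (copForm σ)
    (Double.theta k (Cop H) ((ι) y)))) = _
  rw [theta_cop_apply hS, skewAntipode_apply, IsLinearMap.map_sw (f := fun t => κ (Double.thetaInv k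
    (Cop H) (Double.coinvAntipode (copForm σ) t))) (by fun_prop)]
  refine sw_congr fun a b => ?_
  rw [thetaInv_coinvAntipode_tmul, hσ.thetaInv_mul, Bialgebra.counit_one, one_smul]
  · trans adjointAct σ (T b) (T (S a)) * 1
    · rfl
    · rw [mul_one, antipodeInv_antipode hS]
  -- Left multiplication by i(z) acts through ε because ρ(1) = 1 ⊗ 1 and σ(1, ·) = ε.
  · intro z b h
    rw [hσ.thetaInv_mul, thetaInv_tmul]
    congr 1
    trans (ι) (adjointAct σ 1 (κ b) * κ h)
    · rfl
    · rw [adjointAct_apply, adjointCoact_one, sw_tmul _ _ _ (by fun_prop) (by fun_prop),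
        hσ.one_left, smul_mul_assoc, one_mul]
      rfl

theorem thetaInv_theta_cop (hS : IsUnit (S : Module.End k H)) (y : Cop H) :
    Double.thetaInv k (Cop H) (Double.theta k (Cop H) y) = y := by
  change Double.thetaInv k (Cop H) (Double.theta k (Cop H) ((ι) (κ y))) = y
  rw [theta_cop_apply hS, IsLinearMap.map_sw (f := fun t => Double.thetaInv k (Cop H) t)
    (by fun_prop)]
  simp only [thetaInv_tmul]
  trans sw (Δ (κ y)) fun a b => ε a • (ι) b
  · refine sw_congr fun a b => ?_
    rw [← counit_antipode (R := k) a]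
    rfl
  · exact sw_counit_left (κ y) (fun b => (ι) b) (by fun_prop)

theorem theta_cop_mem_coinvariants (hS : IsUnit (S : Module.End k H)) (x : Cop H) :
    Double.theta k (Cop H) x ∈ Double.coinvariants k (Cop H) := by
  change (Double.proj k (Cop H)).lTensor (Cop H ⊗[k] Cop H) (Δ (Double.theta k (Cop H) x)) =
    Double.theta k (Cop H) x ⊗ₜ[k] 1
  obtain ⟨y, rfl⟩ : ∃ y, x = (ι) y := ⟨κ x, rfl⟩
  rw [theta_cop_apply hS, IsLinearMap.map_sw (f := fun t => (Double.proj k (Cop H)).lTensor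
    (Cop H ⊗[k] Cop H) (Δ t)) (by fun_prop)]
  have h (a b : H) : (Double.proj k (Cop H)).lTensor (Cop H ⊗[k] Cop H)
      (Δ ((ι) (S a) ⊗ₜ[k] (ι) b)) = sw (Δ a) fun a₁ a₂ => sw (Δ b) fun b₁ b₂ =>
        ((ι) (S a₁) ⊗ₜ[k] (ι) b₂) ⊗ₜ[k] (ι) (S a₂ * b₁) := by
    rw [apply_eq_sw (φ := fun t => (Double.proj k (Cop H)).lTensor (Cop H ⊗[k] Cop H) t)
      (by fun_prop), sw_comul_tmul _ _ _ (by fun_prop) (by fun_prop)]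
    simp (disch := fun_prop) only [sw_comul_cop]
    change sw (Δ (S a)) _ = _
    rw [sw_comul_antipode _ _ (by fun_prop) (by fun_prop)]
    rfl
  simp only [h]
  rw [sw_comul_assoc₄ y (fun a₁ a₂ b₁ b₂ => ((ι) (S a₁) ⊗ₜ[k] (ι) b₂) ⊗ₜ[k] (ι) (S a₂ * b₁))
    (by fun_prop) (by fun_prop) (by fun_prop) (by fun_prop),
    IsLinearMap.map_sw (f := fun t => t ⊗ₜ[k] (1 : Cop H)) (by fun_prop)]
  refine sw_congr fun a t => ?_
  rw [← sw_counit_left t (fun b => ((ι) (S a) ⊗ₜ[k] (ι) b) ⊗ₜ[k] (1 : Cop H)) (by fun_prop)]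
  refine sw_congr fun c b => ?_
  exact sw_antipode_mul c (fun x => ((ι) (S a) ⊗ₜ[k] (ι) b) ⊗ₜ[k] (ι) x) (by fun_prop)

/-- The map (b ⊗ h) ⊗ g ↦ ε(b) g S(h₁) ⊗ h₂, with legs of `h` taken in H, is applied to both sides
of the coinvariance equation. On t ⊗ 1 it gives θ of the image of `t` under ε ⊗ id; on t₁ ⊗ π(t₂)
the antipode cancels the second factor of π(t₂), and `t` remains. -/
theorem theta_thetaInv_cop (hS : IsUnit (S : Module.End k H)) {t : Cop H ⊗[k] Cop H}
    (ht : t ∈ Double.coinvariants k (Cop H)) :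
    Double.theta k (Cop H) (Double.thetaInv k (Cop H) t) = t := by
  have hΦ (u v : Cop H) (g : Cop H) : (ε u • sw (Δ (κ v)) fun p q =>
      (g * (ι) (S p)) ⊗ₜ[k] (ι) q) = sw (u ⊗ₜ[k] v) fun b h => ε b • sw (Δ (κ h)) fun p q =>
      (g * (ι) (S p)) ⊗ₜ[k] (ι) q := by
    rw [sw_tmul _ _ _ (by fun_prop) (by fun_prop)]
  have key := (congrArg (fun z => sw z fun s g => sw s fun b h => ε b • sw (Δ (κ h)) fun p q =>
    (g * (ι) (S p)) ⊗ₜ[k] (ι) q) (show (Double.proj k (Cop H)).lTensor (Cop H ⊗[k] Cop H) (Δ t) =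
      t ⊗ₜ[k] 1 from ht)).trans (sw_tmul _ _ _ (by fun_prop) (by fun_prop))
  trans sw t fun b h => ε b • sw (Δ (κ h)) fun p q => (1 * (ι) (S p)) ⊗ₜ[k] (ι) q
  · rw [apply_eq_sw (φ := fun t => Double.theta k (Cop H) (Double.thetaInv k (Cop H) t))
      (by fun_prop)]
    refine sw_congr fun b h => ?_
    rw [thetaInv_tmul, map_smul]
    simp only [one_mul]
    exact congrArg _ (theta_cop_apply hS (κ h))
  refine key.symm.trans ?_
  rw [apply_eq_sw (φ := fun t => sw ((Double.proj k (Cop H)).lTensor (Cop H ⊗[k] Cop H) (Δ t))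
    fun s g => sw s fun b h => ε b • sw (Δ (κ h)) fun p q => (g * (ι) (S p)) ⊗ₜ[k] (ι) q)
    (by fun_prop)]
  refine (sw_congr fun b h => ?_).trans (sw_tmul_eq t)
  rw [LinearMap.lTensor, sw_map _ _ _ _ (by fun_prop) (by fun_prop),
    sw_comul_tmul _ _ _ (by fun_prop) (by fun_prop)]
  simp only [LinearMap.id_apply, ← hΦ, Double.proj, LinearMap.mul'_apply]
  simp (disch := fun_prop) only [sw_comul_cop h, LinearEquiv.apply_symm_apply]
  trans sw (Δ b) fun b₁ b₂ => ε b₁ • (b₂ ⊗ₜ[k] h)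
  · refine sw_congr fun b₁ b₂ => ?_
    rw [sw_smul]
    congr 1
    rw [← sw_comul_assoc (κ h) (fun s p q => (b₂ * (ι) s * (ι) (S p)) ⊗ₜ[k] (ι) q)
      (by fun_prop) (by fun_prop) (by fun_prop)]
    trans sw (Δ (κ h)) fun w q => ε w • (b₂ ⊗ₜ[k] (ι) q)
    · refine sw_congr fun w q => ?_
      have := sw_mul_antipode (k := k) w (fun x => (b₂ * (ι) x) ⊗ₜ[k] (ι) q) (by fun_prop)
      refine Eq.trans (sw_congr fun s p => ?_) (this.trans ?_)
      · rw [mul_assoc]; rfl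
      · exact congrArg (fun x => ε w • (x ⊗ₜ[k] (ι) q)) (mul_one b₂)
    · exact sw_counit_left (κ h) (fun x => b₂ ⊗ₜ[k] (ι) x) (by fun_prop)
  · exact sw_counit_left b (fun x => x ⊗ₜ[k] h) (by fun_prop)

theorem bijOn_theta_cop (hS : IsUnit (S : Module.End k H)) :
    Set.BijOn (Double.theta k (Cop H)) Set.univ (Double.coinvariants k (Cop H)) :=
  ⟨fun x _ => theta_cop_mem_coinvariants hS x,
    fun x _ y _ hxy => by rw [← thetaInv_theta_cop hS x, hxy, thetaInv_theta_cop hS],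
    fun t ht => ⟨Double.thetaInv k (Cop H) t, trivial, theta_thetaInv_cop hS ht⟩⟩

end UnderlineCop

/-! ### The co-opposite and the comparison -/

section CoOpposite

variable {k H : Type*} [Field k] [Ring H] [HopfAlgebra k H] {σ : H →ₗ[k] H →ₗ[k] k}

/-- The skew antipode, as an invertible endomorphism with inverse the antipode of the function
algebra braided group. -/
def IsCoquasitriangular.skewAntipodeUnit (hσ : IsCoquasitriangular σ) : (Module.End k H)ˣ where
  val := skewAntipode σ
  inv := (functionBraidedGroup σ).antipode
  val_inv := LinearMap.ext hσ.skewAntipode_functionBraidedGroup_antipode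
  inv_val := LinearMap.ext hσ.functionBraidedGroup_antipode_skewAntipode

theorem IsCoquasitriangular.isUnit_braiding_underlineCop (hσ : IsCoquasitriangular σ) :
    IsUnit (braiding (convInv σ).flip (underlineCop σ).coact (underlineCop σ).coact :
      Module.End k (H ⊗[k] H)) := by
  rw [underlineCop_coact hσ.isUnit_antipode]
  exact hσ.isUnit_braiding isRightCoaction_adjointCoact

theorem IsCoquasitriangular.isUnit_underlineCop_antipode (hσ : IsCoquasitriangular σ) :
    IsUnit ((underlineCop σ).antipode : Module.End k H) := by
  rw [hσ.underlineCop_antipode]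
  exact hσ.skewAntipodeUnit.isUnit

/-- The inverse braiding cancels the one in the comultiplication, and the inverse of `skewAntipode`
is already known; the other structure maps agree before passing to the co-opposite. -/
theorem IsCoquasitriangular.cop_underlineCop (hσ : IsCoquasitriangular σ) :
    (underlineCop σ).cop (convInv σ).flip = functionBraidedGroup σ := by
  have hS := hσ.isUnit_antipode
  have hΔ : Ring.inverse (braiding (convInv σ).flip (underlineCop σ).coact (underlineCop σ).coact :
      Module.End k (H ⊗[k] H)) ∘ₗ (underlineCop σ).comul = comul := by
    have h := Ring.inverse_mul_cancel _ hσ.isUnit_braiding_underlineCop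
    rw [hσ.underlineCop_comul, ← underlineCop_coact (σ := σ) hS, ← LinearMap.comp_assoc,
      ← Module.End.mul_eq_comp, h, Module.End.one_eq_id, LinearMap.id_comp]
  have hA : Ring.inverse ((underlineCop σ).antipode : Module.End k H) =
      (functionBraidedGroup σ).antipode := by
    rw [hσ.underlineCop_antipode]
    exact Ring.inverse_unit hσ.skewAntipodeUnit
  rw [BraidedHopfData.cop, hΔ, hA, underlineCop_coact hS, hσ.underlineCop_mul, underlineCop_one,
    underlineCop_counit hS]
  rfl

end CoOpposite

end BraidedTransmutation

end

open BraidedTransmutation in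
theorem mainTheorem5 {k H : Type*} [Field k] [Ring H] [HopfAlgebra k H]
    (σ : H →ₗ[k] H →ₗ[k] k) (hσ : IsCoquasitriangular σ) :
    -- the inverses that enter the construction exist, and `θ` is a bijection onto the coinvariants
    IsUnit (HopfAlgebra.antipode k : Module.End k H) ∧
    Set.BijOn (Double.theta k (Cop H)) Set.univ (Double.coinvariants k (Cop H)) ∧
    IsUnit (braiding (convInv σ).flip (underlineCop σ).coact (underlineCop σ).coact :
      Module.End k (TensorProduct k H H)) ∧
    IsUnit ((underlineCop σ).antipode : Module.End k H) ∧
    -- the co-opposite, with respect to `σ₂₁⁻¹`, is the function algebra braided group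
    (underlineCop σ).cop (convInv σ).flip = functionBraidedGroup σ ∧
    -- and this is a Hopf algebra in the braided category `M^(H,σ)`
    (functionBraidedGroup σ).IsBraidedHopfAlgebra σ :=
  ⟨hσ.isUnit_antipode, bijOn_theta_cop hσ.isUnit_antipode, hσ.isUnit_braiding_underlineCop,
    hσ.isUnit_underlineCop_antipode, hσ.cop_underlineCop,
    hσ.isBraidedHopfAlgebra_functionBraidedGroup⟩
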